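/- Let $(\mathcal S,P)$ be a probability space, $\mathcal X\subset\mathbb R^n$ a nonempty closed convex set, $U\supseteq\mathcal X$ an open convex set (for instance $U=\mathbb R^n$), and let $f:U\times\mathcal S\to\mathbb R$ and $\rho:\mathcal S\to\mathbb R$ be such that $f(x;\cdot)$ and $\rho$ are measurable and, for each $s\in\mathcal S$, $f(\cdot;s)$ is $\rho(s)$-weakly convex, i.e. $x\mapsto f(x;s)+\frac{\rho(s)}{2}\|x\|_2^2$ is convex on $U$. Assume that $f(x;\cdot)$ is $P$-integrable for $x\in\mathcal X$ and put $F(x)=\mathbb E_P[f(x;S)]$, $x\in\mathcal X$. Write $\partial f(x;s)$ for the Fréchet subdifferential of $f(\cdot;s)$ at $x$, and $\partial F(x)$ for the Fréchet subdifferential at $x$ of the objective $F$ of the constrained problem, i.e. of $F$ extended by $+\infty$ outside $\mathcal X$ (so $\partial F(x)$ contains the normal directions to $\mathcal X$ at $x$). Assume: 1. there are $C_1,C_2<\infty$ such that for every $x\in\mathcal X$, every measurable selection $f'(x;s)\in\partial f(x;s)$ and every $F'(x)\in\partial F(x)$, $$\operatorname{Var}(f'(x;S)):=\mathbb E\big\|f'(x;S)-\mathbb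 E f'(x;S)\big\|_2^2\le C_1\|F'(x)\|_2^2+C_2,$$ (in particular, $f'(x;S)$ has a finite second moment whenever $\partial F(x)\ne\emptyset$); 2. $\mathbb E[\rho(S)^2]<\infty$, and $\lambda\ge 0$ satisfies $\mathbb E[\rho(S)]<\lambda$; 3. $\inf_{x\in\mathcal X}F(x)>-\infty$. Let $(\alpha_k)_{k\ge1}$ be positive stepsizes with $\sum_k\alpha_k^2<\infty$, let $S_1,S_2,\dots$ be i.i.d. with law $P$, let $x_1\in\mathbb R^n$ be deterministic, and let the iterates be generated by the full proximal model $f_x(y;s)=f(y;s)+\frac{\rho(s)}2\|y-x\|_2^2$: $$x_{k+1}=\operatorname*{argmin}_{y\in\mathcal X}\Big\{f(y;S_k)+\frac{\rho(S_k)}{2}\|y-x_k\|_2^2+\frac1{2\alpha_k}\|y-x_k\|_2^2\Big\},\qquad k\ge1.$$ Let $F_\lambda(x)=\inf_{y\in\mathcal X}\{F(y)+\frac\lambda2\|y-x\|_2^2\}$, $x\in\mathbb R^n$, be the Moreau envelope. Then $F_\lambda$ is differentiable on $\mathbb R^n$, there is a finite (real-valued) random variable $G_\lambda$ such that $F_\lambda(x_k)\to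 G_\lambda$ almost surely, and $$\sum_{k=1}^\infty\alpha_k\|\nabla F_\lambda(x_k)\|_2^2<\infty\quad\text{almost surely.}$$ -/

import Mathlib

open MeasureTheory ProbabilityTheory Filter Topology
open scoped ENNReal

namespace ModelOpt

/-- The Fréchet subdifferential at `x` of the function that equals `φ` on `D` and `+∞` off `D`:
all `v` with `φ y ≥ φ x + ⟪v, y - x⟫ - o(‖y - x‖)` as `y → x` in `D`. If `D` is a neighbourhood
of `x`, this is the usual Fréchet subdifferential of `φ` at `x`. -/
def frechetSubdiff {E : Type*} [NormedAddCommGroup E] [InnerProductSpace ℝ E]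
    (D : Set E) (φ : E → ℝ) (x : E) : Set E :=
  {v | ∀ ε : ℝ, 0 < ε → ∀ᶠ y in 𝓝[D] x, φ x + inner ℝ v (y - x) - ε * ‖y - x‖ ≤ φ y}

/-- The population objective `F x = E_P[f(x; S)]`. -/
noncomputable def population {E Sp : Type*} [MeasurableSpace Sp]
    (P : Measure Sp) (f : E → Sp → ℝ) (x : E) : ℝ :=
  ∫ s, f x s ∂P

/-- The variance `E‖g(S) - E g(S)‖²` of a random vector, with values in `[0, ∞]`. On a probability
space a measurable `g` that is not square integrable has variance `∞`. -/
noncomputable def vecVariance {E Sp : Type*} [NormedAddCommGroup E] [NormedSpace ℝ E]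
    [MeasurableSpace Sp] (P : Measure Sp) (g : Sp → E) : ℝ≥0∞ :=
  ∫⁻ s, ‖g s - ∫ t, g t ∂P‖ₑ ^ 2 ∂P

/-- The relative-variance assumption: there are finite constants `C₁, C₂` such that
`Var(f'(x; S)) ≤ C₁ ‖F'(x)‖² + C₂` for every `x ∈ X`, all measurable selections
`f'(x; s) ∈ ∂f(x; s)` and all `F'(x) ∈ ∂F(x)`. The losses live on `U ⊇ X`; the objective `F` of the
constrained problem lives on `X`. -/
def RelativeVariance {E Sp : Type*} [NormedAddCommGroup E] [InnerProductSpace ℝ E]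
    [MeasurableSpace E] [MeasurableSpace Sp]
    (U X : Set E) (P : Measure Sp) (f : E → Sp → ℝ) : Prop :=
  ∃ C₁ C₂ : ℝ, ∀ x ∈ X, ∀ g : Sp → E, Measurable g →
    (∀ s, g s ∈ frechetSubdiff U (fun y => f y s) x) →
    ∀ v ∈ frechetSubdiff X (population P f) x,
      vecVariance P g ≤ ENNReal.ofReal (C₁ * ‖v‖ ^ 2 + C₂)

/-- The Moreau envelope `F_lam x = inf_{y ∈ X} {F y + (lam / 2) ‖y - x‖²}`. -/
noncomputable def moreauEnvelope {E : Type*} [NormedAddCommGroup E]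
    (X : Set E) (F : E → ℝ) (lam : ℝ) (x : E) : ℝ :=
  ⨅ y : X, (F y + lam / 2 * ‖(y : E) - x‖ ^ 2)

/-- The full proximal model `f_x(y; s) = f(y; s) + (ρ(s) / 2) ‖y - x‖²`. -/
noncomputable def proxModel {E Sp : Type*} [NormedAddCommGroup E]
    (f : E → Sp → ℝ) (ρ : Sp → ℝ) (x : E) (s : Sp) (y : E) : ℝ :=
  f y s + ρ s / 2 * ‖y - x‖ ^ 2

/-- One model-based step from `x` to `x'` with model `m` and stepsize `a`:
`x' ∈ argmin_{y ∈ X} {m y + (1 / (2 a)) ‖y - x‖²}`. -/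
def IsModelStep {E : Type*} [NormedAddCommGroup E]
    (X : Set E) (m : E → ℝ) (a : ℝ) (x x' : E) : Prop :=
  x' ∈ X ∧ IsMinOn (fun y => m y + 1 / (2 * a) * ‖y - x‖ ^ 2) X x'

end ModelOpt

/-!
Let `F` be the population objective, `r = E ρ`, `M` its Moreau envelope and `x̂` the proximal point
of `x`, i.e. the minimizer over `X` of the `(lam - r)`-strongly convex function
`F + (lam / 2) ‖· - x‖²`. It exists because `F` is lower semicontinuous on `X`
(`lowerSemicontinuousOn_population`); the proximal map is Lipschitz, so that `M` is differentiable
with gradient `lam (x - x̂) ∈ ∂F(x̂)` (`hasGradientAt_moreauEnvelope`).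

The envelope is a Lyapunov function. The next iterate `x'` satisfies
`M x' ≤ F x̂ + (lam / 2) ‖x' - x̂‖²`, so it suffices to bound `E‖x' - x̂‖²` for fixed `x`
(`integral_norm_sub_sq_le`). Strong convexity of the model step and a measurable selection `g` of
subgradients of the losses at `x̂` bound `‖x' - x̂‖²` by a quadratic expression in `x' - x`. The
mean of `g` must be compared with `v = lam (x - x̂)`. It need not equal `v`, nor be bounded in terms of
`v`, since `v` may contain a normal component; only the variance of `g` is controlled. The remedy is
to choose `g` after the step is known: take `g(s)` to be exposed in the direction
`d = E[x'] - x̂`, so that `⟪g(s), d⟫` is the directional derivative of the loss. By dominated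
convergence `⟪E g, d⟫` is then the directional derivative of `F`, which is at least `⟪v, d⟫`
because `x̂ + d ∈ X`. Hence `E g` may be replaced by `v` under the expectation, and after
completing the square the error is `α²` times the second moment of `ρ (x - x̂) - (g - E g + v)`,
which the relative-variance assumption bounds by a multiple of `‖x - x̂‖²` plus a constant. This
gives
`E[M x'] - β ≤ (1 + A α²) (M x - β) + B α² - α lam (lam - r) ‖x - x̂‖²`, with `β` a lower bound of
`F` on `X` (`exists_integral_moreauEnvelope_le`), and the Robbins–Siegmund theorem
(`ae_tendsto_and_summable_of_almost_supermartingale`) concludes.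

The exposed measurable selection is obtained as the limit of the Yosida approximations of the
directional derivative (`exists_measurable_subgradient`). These approximations and the iterates are
measurable because minimizers of strongly convex random functions are (`measurable_of_isMinOn`).
-/

namespace ModelOpt

/-! ### Minimizers of strongly convex functions -/

/-- Quadratic growth of a strongly convex function away from its minimizer. -/
lemma add_sq_le_of_isMinOn {E : Type*} [NormedAddCommGroup E] [NormedSpace ℝ E]
    {X : Set E} {m : ℝ} {φ : E → ℝ} {z y : E} (hφ : StrongConvexOn X m φ) (hz : z ∈ X)
    (hmin : IsMinOn φ X z) (hy : y ∈ X) : φ z + m / 2 * ‖y - z‖ ^ 2 ≤ φ y := by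
  have key : ∀ t : ℝ, t ∈ Set.Ioo (0 : ℝ) 1 → (1 - t) * (m / 2 * ‖y - z‖ ^ 2) ≤ φ y - φ z := by
    intro t ht
    have h1 := hφ.2 hz hy (sub_nonneg.2 ht.2.le) ht.1.le (by ring)
    have h2 : φ z ≤ φ ((1 - t) • z + t • y) :=
      hmin (hφ.1 hz hy (sub_nonneg.2 ht.2.le) ht.1.le (by ring))
    simp only [smul_eq_mul] at h1
    rw [norm_sub_rev] at h1
    have h3 : t * ((1 - t) * (m / 2 * ‖y - z‖ ^ 2)) ≤ t * (φ y - φ z) := by linarith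
    exact le_of_mul_le_mul_left h3 ht.1
  have hlim : Tendsto (fun t : ℝ => (1 - t) * (m / 2 * ‖y - z‖ ^ 2)) (𝓝[>] 0)
      (𝓝 ((1 - 0) * (m / 2 * ‖y - z‖ ^ 2))) :=
    (Continuous.tendsto (by fun_prop) 0).mono_left nhdsWithin_le_nhds
  have := le_of_tendsto hlim (by
    filter_upwards [Ioo_mem_nhdsGT (zero_lt_one' ℝ)] with t ht using key t ht)
  linarith

/-- Strong convexity makes the function coercive, so no lower bound has to be assumed. -/
lemma exists_isMinOn_of_strongConvexOn {E : Type*} [NormedAddCommGroup E] [NormedSpace ℝ E]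
    [ProperSpace E] {X : Set E} {m : ℝ} {φ : E → ℝ} (hXc : IsClosed X) (hXne : X.Nonempty)
    (hm : 0 < m) (hφ : StrongConvexOn X m φ) (hlsc : LowerSemicontinuousOn φ X) :
    ∃ z ∈ X, IsMinOn φ X z := by
  obtain ⟨x₀, hx₀⟩ := hXne
  have hmin : ∀ R : ℝ, 0 ≤ R →
      ∃ z ∈ X ∩ Metric.closedBall x₀ R, IsMinOn φ (X ∩ Metric.closedBall x₀ R) z := by
    intro R hR
    exact LowerSemicontinuousOn.exists_isMinOn ⟨x₀, hx₀, by simpa using hR⟩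
      ((isCompact_closedBall x₀ R).inter_left hXc) (hlsc.mono Set.inter_subset_left)
  obtain ⟨z₁, hz₁, hmin₁⟩ := hmin 1 zero_le_one
  have hz₁x : φ z₁ ≤ φ x₀ := hmin₁ ⟨hx₀, by simp⟩
  -- Strong convexity and the lower bound on the unit ball force growth away from `x₀`.
  have hfar : ∀ y ∈ X, 1 + 2 * (φ x₀ - φ z₁) / m < ‖y - x₀‖ → φ x₀ ≤ φ y := by
    intro y hy hr
    set r := ‖y - x₀‖ with hrdef
    have hq : 0 ≤ 2 * (φ x₀ - φ z₁) / m := div_nonneg (by linarith) hm.le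
    have hr1 : 1 < r := by linarith
    have hr0 : 0 < r := by linarith
    have ha : 0 ≤ 1 - 1 / r := by rw [sub_nonneg, div_le_one hr0]; exact hr1.le
    have hb : 0 ≤ 1 / r := by positivity
    have h1 := hφ.2 hx₀ hy ha hb (by ring)
    have hmem : (1 - 1 / r) • x₀ + (1 / r) • y ∈ X ∩ Metric.closedBall x₀ 1 := by
      refine ⟨hφ.1 hx₀ hy ha hb (by ring), ?_⟩
      rw [mem_closedBall_iff_norm]
      have : (1 - 1 / r) • x₀ + (1 / r) • y - x₀ = (1 / r) • (y - x₀) := by module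
      rw [this, norm_smul, ← hrdef, Real.norm_of_nonneg hb]
      field_simp
      exact le_refl _
    have h2 : φ z₁ ≤ _ := hmin₁ hmem
    simp only [smul_eq_mul] at h1
    rw [norm_sub_rev, ← hrdef] at h1
    have h3 : r * φ z₁ ≤ (r - 1) * φ x₀ + φ y - (r - 1) * (m / 2 * r) := by
      have h4 := mul_le_mul_of_nonneg_left (h2.trans h1) hr0.le
      have h5 : r * ((1 - 1 / r) * φ x₀ + 1 / r * φ y - (1 - 1 / r) * (1 / r) * (m / 2 * r ^ 2))
          = (r - 1) * φ x₀ + φ y - (r - 1) * (m / 2 * r) := by field_simp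
      linarith
    have h6 : φ x₀ - φ z₁ < (r - 1) * (m / 2) := by
      have : 2 * (φ x₀ - φ z₁) / m < r - 1 := by linarith
      rw [div_lt_iff₀ hm] at this
      linarith
    nlinarith
  obtain ⟨z, hz, hminz⟩ := hmin (1 + 2 * (φ x₀ - φ z₁) / m)
    (add_nonneg zero_le_one (div_nonneg (by linarith) hm.le))
  refine ⟨z, hz.1, fun y hy => ?_⟩
  by_cases hyr : ‖y - x₀‖ ≤ 1 + 2 * (φ x₀ - φ z₁) / m
  · exact hminz ⟨hy, mem_closedBall_iff_norm.2 hyr⟩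
  · have h1 : φ z ≤ φ x₀ := hminz ⟨hx₀, by
      simpa using add_nonneg zero_le_one (div_nonneg (by linarith) hm.le)⟩
    exact h1.trans (hfar y hy (not_le.1 hyr))

/-- The minimizer of a strongly convex random function depends measurably on the parameter: it is
the limit of the minimizers over the first `k` points of a dense sequence. -/
lemma measurable_of_isMinOn {E Ω : Type*} [NormedAddCommGroup E] [NormedSpace ℝ E]
    [SecondCountableTopology E] [MeasurableSpace E] [BorelSpace E] [MeasurableSpace Ω]
    {X : Set E} {m : ℝ} (hm : 0 < m) {φ : Ω → E → ℝ}
    (hmeas : ∀ y ∈ X, Measurable fun ω => φ ω y) (hcont : ∀ ω, ContinuousOn (φ ω) X)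
    (hφ : ∀ ω, StrongConvexOn X m (φ ω)) {z : Ω → E} (hz : ∀ ω, z ω ∈ X)
    (hmin : ∀ ω, IsMinOn (φ ω) X (z ω)) : Measurable z := by
  classical
  rcases isEmpty_or_nonempty Ω with hΩ | ⟨⟨ω₀⟩⟩
  · exact measurable_of_empty z
  have : Nonempty X := ⟨⟨z ω₀, hz ω₀⟩⟩
  let d : ℕ → X := TopologicalSpace.denseSeq X
  let u : ℕ → Ω → E := fun k => Nat.rec (fun _ => (d 0 : E))
    (fun k uk ω => if φ ω (d (k + 1)) < φ ω (uk ω) then (d (k + 1) : E) else uk ω) k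
  have hu0 : ∀ ω, u 0 ω = d 0 := fun ω => rfl
  have hus : ∀ k ω, u (k + 1) ω = if φ ω (d (k + 1)) < φ ω (u k ω) then (d (k + 1) : E)
      else u k ω := fun k ω => rfl
  have hmu : ∀ k, Measurable (u k) ∧ Measurable fun ω => φ ω (u k ω) := by
    intro k
    induction k with
    | zero => exact ⟨measurable_const, hmeas _ (d 0).2⟩
    | succ k ih =>
      have hset : MeasurableSet {ω | φ ω (d (k + 1)) < φ ω (u k ω)} :=
        measurableSet_lt (hmeas _ (d (k + 1)).2) ih.2
      refine ⟨Measurable.ite hset measurable_const ih.1, ?_⟩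
      have : (fun ω => φ ω (u (k + 1) ω)) = fun ω =>
          if φ ω (d (k + 1)) < φ ω (u k ω) then φ ω (d (k + 1)) else φ ω (u k ω) := by
        funext ω
        rw [hus]
        split_ifs <;> rfl
      rw [this]
      exact Measurable.ite hset (hmeas _ (d (k + 1)).2) ih.2
  have huX : ∀ k ω, u k ω ∈ X := by
    intro k ω
    induction k with
    | zero => exact (d 0).2
    | succ k ih => rw [hus]; split_ifs; exacts [(d (k + 1)).2, ih]
  have hule : ∀ k ω, ∀ j ≤ k, φ ω (u k ω) ≤ φ ω (d j) := by
    intro k ω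
    induction k with
    | zero => intro j hj; rw [Nat.le_zero.1 hj, hu0]
    | succ k ih =>
      intro j hj
      rw [hus]
      rcases Nat.le_succ_iff.1 hj with hj | rfl
      · split_ifs with h
        · exact h.le.trans (ih j hj)
        · exact ih j hj
      · split_ifs with h
        · exact le_rfl
        · exact not_lt.1 h
  refine measurable_of_tendsto_metrizable (fun k => (hmu k).1) ?_
  rw [tendsto_pi_nhds]
  intro ω
  rw [tendsto_iff_norm_sub_tendsto_zero]
  have hval : Tendsto (fun k => φ ω (u k ω) - φ ω (z ω)) atTop (𝓝 0) := by
    rw [Metric.tendsto_atTop]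
    intro ε hε
    have hc : ContinuousAt (fun y : X => φ ω y) ⟨z ω, hz ω⟩ :=
      (continuousOn_iff_continuous_domRestrict.1 (hcont ω)).continuousAt
    have hnear : {y : X | φ ω y < φ ω (z ω) + ε} ∈ 𝓝 (⟨z ω, hz ω⟩ : X) :=
      hc.eventually (gt_mem_nhds (lt_add_of_pos_right _ hε))
    obtain ⟨j, hj⟩ := (TopologicalSpace.denseRange_denseSeq X).exists_mem_open
      isOpen_interior ⟨_, mem_interior_iff_mem_nhds.2 hnear⟩
    refine ⟨j, fun k hk => ?_⟩
    have hj' := interior_subset hj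
    have h1 : φ ω (d j) < φ ω (z ω) + ε := hj'
    have h2 := hule k ω j hk
    have h3 : φ ω (z ω) ≤ φ ω (u k ω) := hmin ω (huX k ω)
    rw [Real.dist_eq, sub_zero, abs_of_nonneg (by linarith)]
    linarith
  have hsq : Tendsto (fun k => ‖u k ω - z ω‖ ^ 2) atTop (𝓝 0) := by
    refine squeeze_zero (fun k => sq_nonneg _) (g := fun k =>
      2 / m * (φ ω (u k ω) - φ ω (z ω))) (fun k => ?_) (by simpa using hval.const_mul (2 / m))
    have := add_sq_le_of_isMinOn (hφ ω) (hz ω) (hmin ω) (huX k ω)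
    rw [div_mul_eq_mul_div, le_div_iff₀ hm]
    linarith
  have := hsq.sqrt
  simpa [Real.sqrt_sq] using this

/-! ### Subgradients and directional derivatives of convex functions -/

section InnerProduct

variable {E : Type*} [NormedAddCommGroup E] [InnerProductSpace ℝ E]

/-- Adding `(b / 2) ‖y - c‖²` to an `r`-weakly convex function gives modulus `b - r`. -/
lemma strongConvexOn_add_sq {X : Set E} {p : E → ℝ} {r : ℝ}
    (hp : ConvexOn ℝ X fun y => p y + r / 2 * ‖y‖ ^ 2) (b : ℝ) (c : E) :
    StrongConvexOn X (b - r) fun y => p y + b / 2 * ‖y - c‖ ^ 2 := by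
  rw [strongConvexOn_iff_convex]
  have haff : ConvexOn ℝ X fun y => -b * inner ℝ c y + b / 2 * ‖c‖ ^ 2 := by
    refine ⟨hp.1, fun x _ y _ s t _ _ hst => le_of_eq ?_⟩
    simp only [inner_add_right, inner_smul_right, smul_eq_mul]
    linear_combination -(b / 2 * ‖c‖ ^ 2) * hst
  refine (hp.add haff).congr fun y _ => ?_
  simp only [Pi.add_apply]
  rw [norm_sub_sq_real, real_inner_comm]
  ring

/-- The optimality condition of a proximal step, in subgradient form. -/
lemma inner_le_of_isMinOn_prox {X : Set E} {p : E → ℝ} {t : ℝ}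
    (hp : ConvexOn ℝ X p) {c J y : E} (hJ : J ∈ X)
    (hmin : IsMinOn (fun y => p y + 1 / t / 2 * ‖y - c‖ ^ 2) X J) (hy : y ∈ X) :
    p J + inner ℝ (t⁻¹ • (c - J)) (y - J) ≤ p y := by
  have hs := strongConvexOn_add_sq (r := 0) (p := p) (by simpa using hp) (1 / t) c
  have h := add_sq_le_of_isMinOn hs hJ hmin hy
  have hyc : y - c = (y - J) - (c - J) := by abel
  rw [hyc, norm_sub_sq_real (y - J), norm_sub_rev J c] at h
  rw [real_inner_smul_left, real_inner_comm]
  simp only [one_div] at h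
  linarith

/-- A convex function on a finite-dimensional space lies above a cone at each of its points. -/
lemma exists_sub_norm_le [FiniteDimensional ℝ E] {p : E → ℝ} (hp : ConvexOn ℝ Set.univ p) (c : E) :
    ∃ L : ℝ, 0 ≤ L ∧ ∀ y, p c - L * ‖y - c‖ ≤ p y := by
  obtain ⟨K, s, hs, hL⟩ := hp.locallyLipschitz c
  obtain ⟨r, hr, hball⟩ := Metric.mem_nhds_iff.1 hs
  refine ⟨K, K.2, fun y => ?_⟩
  -- Compare with a point of the segment from `c` to `y` near `c`.
  obtain ⟨θ, hθ0, hθ1, hθr⟩ : ∃ θ : ℝ, 0 < θ ∧ θ ≤ 1 ∧ θ * ‖y - c‖ < r := by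
    refine ⟨min 1 (r / (‖y - c‖ + 1)), by positivity, min_le_left _ _, ?_⟩
    calc min 1 (r / (‖y - c‖ + 1)) * ‖y - c‖ ≤ r / (‖y - c‖ + 1) * ‖y - c‖ := by
          gcongr; exact min_le_right _ _
      _ < r := by
          rw [div_mul_eq_mul_div, div_lt_iff₀ (by positivity)]
          nlinarith
  have hw : (1 - θ) • c + θ • y - c = θ • (y - c) := by module
  have hn : ‖(1 - θ) • c + θ • y - c‖ = θ * ‖y - c‖ := by
    rw [hw, norm_smul, Real.norm_of_nonneg hθ0.le]
  have h1 := hL.dist_le_mul _ (hball (by rw [mem_ball_iff_norm, hn]; exact hθr)) c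
    (hball (Metric.mem_ball_self hr))
  rw [dist_eq_norm, dist_eq_norm, hn, Real.norm_eq_abs] at h1
  have h2 := hp.2 (Set.mem_univ c) (Set.mem_univ y) (sub_nonneg.2 hθ1) hθ0.le (by ring)
  simp only [smul_eq_mul] at h2
  have h3 := (abs_le.1 h1).1
  have h4 : θ * (p c - K * ‖y - c‖) ≤ θ * p y := by linarith
  exact le_of_mul_le_mul_left h4 hθ0

/-- Monotonicity of the Yosida approximations `A = s⁻¹ (c - J)`, `B = t⁻¹ (c - K)`, `s ≤ t`:
`‖A - B‖² ≤ ‖A‖² - ‖B‖²`. -/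
lemma yosida_norm_sub_sq_le {p : E → ℝ} {c A B : E} {s t : ℝ} (hs : 0 < s) (hst : s ≤ t)
    (hA : ∀ y, p (c - s • A) + inner ℝ A (y - (c - s • A)) ≤ p y)
    (hB : ∀ y, p (c - t • B) + inner ℝ B (y - (c - t • B)) ≤ p y) :
    ‖A - B‖ ^ 2 ≤ ‖A‖ ^ 2 - ‖B‖ ^ 2 := by
  have h1 := hA (c - t • B)
  have h2 := hB (c - s • A)
  have e1 : c - t • B - (c - s • A) = s • A - t • B := by abel
  have e2 : c - s • A - (c - t • B) = t • B - s • A := by abel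
  rw [e1] at h1
  rw [e2] at h2
  simp only [inner_sub_right, inner_smul_right, real_inner_self_eq_norm_sq] at h1 h2
  rw [real_inner_comm A B] at h2
  have e3 : ‖A - B‖ ^ 2 = ‖A‖ ^ 2 - 2 * inner ℝ A B + ‖B‖ ^ 2 := norm_sub_sq_real A B
  have h0 := sq_nonneg ‖A - B‖
  have hkey : (t - s) * (‖B‖ ^ 2 - inner ℝ A B) + s * ‖A - B‖ ^ 2 ≤ 0 := by
    rw [e3]; linarith
  rcases hst.eq_or_lt with rfl | hlt
  · have : ‖A - B‖ ^ 2 ≤ 0 := by nlinarith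
    have hAB : A - B = 0 := by
      rw [← norm_eq_zero]; exact pow_eq_zero_iff two_ne_zero |>.1 (le_antisymm this h0)
    rw [sub_eq_zero.1 hAB]; simp
  · have : ‖B‖ ^ 2 - inner ℝ A B ≤ 0 := by
      by_contra! h
      nlinarith [mul_pos (sub_pos.2 hlt) h, mul_nonneg hs.le h0]
    linarith

/-- A convex random function has a measurable subgradient at every point: the limit of its Yosida
approximations, i.e. the subgradient of least norm. -/
lemma exists_measurable_subgradient [FiniteDimensional ℝ E] [MeasurableSpace E] [BorelSpace E]
    {Sp : Type*} [MeasurableSpace Sp] {p : Sp → E → ℝ}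
    (hp : ∀ s, ConvexOn ℝ Set.univ (p s)) (hmeas : ∀ y, Measurable fun s => p s y) (c : E) :
    ∃ g : Sp → E, Measurable g ∧ ∀ s y, p s c + inner ℝ (g s) (y - c) ≤ p s y := by
  have : SecondCountableTopology E := secondCountable_of_proper (α := E)
  have hcont : ∀ s, Continuous (p s) := fun s => (hp s).locallyLipschitz.continuous
  let t : ℕ → ℝ := fun k => 1 / ((k : ℝ) + 1)
  have ht : ∀ k, 0 < t k := fun k => Nat.one_div_pos_of_nat
  have ht0 : Tendsto t atTop (𝓝 0) := tendsto_one_div_add_atTop_nhds_zero_nat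
  have htmono : Antitone t := fun i j hij => Nat.one_div_le_one_div hij
  have hsc : ∀ k s, StrongConvexOn Set.univ (1 / t k)
      fun y => p s y + 1 / t k / 2 * ‖y - c‖ ^ 2 := fun k s => by
    simpa using strongConvexOn_add_sq (r := 0) (p := p s) (by simpa using hp s) (1 / t k) c
  have hc : ∀ k s, Continuous fun y => p s y + 1 / t k / 2 * ‖y - c‖ ^ 2 := fun k s =>
    (hcont s).add (by fun_prop)
  choose J _ hJ using fun k s => exists_isMinOn_of_strongConvexOn isClosed_univ
    Set.univ_nonempty (one_div_pos.2 (ht k)) (hsc k s)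
    ((hc k s).lowerSemicontinuous.lowerSemicontinuousOn _)
  have hJmeas : ∀ k, Measurable (J k) := fun k =>
    measurable_of_isMinOn (one_div_pos.2 (ht k)) (fun y _ => (hmeas y).add_const _)
      (fun s => (hc k s).continuousOn) (hsc k) (fun _ => Set.mem_univ _) (hJ k)
  let A : ℕ → Sp → E := fun k s => (t k)⁻¹ • (c - J k s)
  have hJA : ∀ k s, J k s = c - t k • A k s := fun k s => by
    simp only [A]; rw [smul_inv_smul₀ (ht k).ne']; abel
  have hsub : ∀ k s y, p s (c - t k • A k s) + inner ℝ (A k s) (y - (c - t k • A k s)) ≤ p s y := by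
    intro k s y
    rw [← hJA]
    exact inner_le_of_isMinOn_prox (hp s) (Set.mem_univ _) (hJ k s) (Set.mem_univ _)
  have hmono : ∀ s i j, i ≤ j → ‖A j s - A i s‖ ^ 2 ≤ ‖A j s‖ ^ 2 - ‖A i s‖ ^ 2 :=
    fun s i j hij => yosida_norm_sub_sq_le (ht j) (htmono hij) (hsub j s) (hsub i s)
  have hlim : ∀ s, ∃ a, Tendsto (fun k => A k s) atTop (𝓝 a) := by
    intro s
    obtain ⟨L, hL0, hL⟩ := exists_sub_norm_le (hp s) c
    have hbdd : ∀ k, ‖A k s‖ ≤ L := by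
      intro k
      have h1 := hsub k s c
      have h2 := hL (c - t k • A k s)
      have e1 : c - (c - t k • A k s) = t k • A k s := by abel
      have e2 : c - t k • A k s - c = -(t k • A k s) := by abel
      rw [e1, inner_smul_right, real_inner_self_eq_norm_sq] at h1
      rw [e2, norm_neg, norm_smul, Real.norm_of_nonneg (ht k).le] at h2
      by_contra! h
      have h3 : t k * (‖A k s‖ * (‖A k s‖ - L)) ≤ 0 := by linarith
      have h4 : 0 < t k * (‖A k s‖ * (‖A k s‖ - L)) :=
        mul_pos (ht k) (mul_pos (hL0.trans_lt h) (sub_pos.2 h))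
      linarith
    have hN : Tendsto (fun k => ‖A k s‖ ^ 2) atTop (𝓝 (⨆ k, ‖A k s‖ ^ 2)) := by
      refine tendsto_atTop_ciSup (fun i j hij => ?_) ⟨L ^ 2, ?_⟩
      · have := hmono s i j hij
        linarith [sq_nonneg ‖A j s - A i s‖]
      · rintro _ ⟨k, rfl⟩
        exact pow_le_pow_left₀ (norm_nonneg _) (hbdd k) 2
    have hcau : CauchySeq fun k => A k s := by
      rw [Metric.cauchySeq_iff']
      intro ε hε
      obtain ⟨N, hNε⟩ := Metric.cauchySeq_iff'.1 hN.cauchySeq (ε ^ 2) (by positivity)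
      refine ⟨N, fun k hk => ?_⟩
      rw [dist_eq_norm]
      refine lt_of_pow_lt_pow_left₀ 2 hε.le ((hmono s N k hk).trans_lt ?_)
      exact (le_abs_self _).trans_lt (by simpa [Real.dist_eq] using hNε k hk)
    exact cauchySeq_tendsto_of_complete hcau
  choose g hg using hlim
  refine ⟨g, measurable_of_tendsto_metrizable (f := A)
    (fun k => ((measurable_const.sub (hJmeas k)).const_smul _)) (tendsto_pi_nhds.2 hg), ?_⟩
  intro s y
  have hJc : Tendsto (fun k => c - t k • A k s) atTop (𝓝 c) := by
    simpa using (tendsto_const_nhds (x := c)).sub (ht0.smul (hg s))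
  refine le_of_tendsto_of_tendsto ((((hcont s).tendsto c).comp hJc).add
    ((hg s).inner (tendsto_const_nhds.sub hJc))) tendsto_const_nhds
    (Eventually.of_forall fun k => hsub k s y)

/-- The one-sided directional derivative `h'(x; y)`. -/
noncomputable def dirDeriv (h : E → ℝ) (x y : E) : ℝ :=
  derivWithin (fun t : ℝ => h (x + t • y)) (Set.Ioi 0) 0

variable {U : Set E} {h : E → ℝ} {x : E}

lemma eventually_add_smul_mem (hU : IsOpen U) (hx : x ∈ U) (y : E) :
    ∀ᶠ t : ℝ in 𝓝[>] 0, x + t • y ∈ U := by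
  have hc : Continuous fun t : ℝ => x + t • y := by fun_prop
  exact (hc.continuousAt.eventually (by simpa using hU.mem_nhds hx)).filter_mono nhdsWithin_le_nhds

lemma convexOn_line (hh : ConvexOn ℝ U h) (x y : E) :
    ConvexOn ℝ ((fun t : ℝ => x + t • y) ⁻¹' U) fun t : ℝ => h (x + t • y) := by
  have := hh.comp_affineMap (AffineMap.lineMap x (x + y))
  have e : ⇑(AffineMap.lineMap x (x + y) : ℝ →ᵃ[ℝ] E) = fun t : ℝ => x + t • y := by
    funext t; simp [AffineMap.lineMap_apply, add_comm]
  rw [e] at this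
  exact this

lemma zero_mem_interior_line (hU : IsOpen U) (hx : x ∈ U) (y : E) :
    (0 : ℝ) ∈ interior ((fun t : ℝ => x + t • y) ⁻¹' U) := by
  rw [(hU.preimage (by fun_prop)).interior_eq]
  simpa using hx

lemma tendsto_dirDeriv (hU : IsOpen U) (hh : ConvexOn ℝ U h) (hx : x ∈ U) (y : E) :
    Tendsto (fun t : ℝ => t⁻¹ * (h (x + t • y) - h x)) (𝓝[>] 0) (𝓝 (dirDeriv h x y)) := by
  have := ((convexOn_line hh x y).hasDerivWithinAt_rightDeriv_of_mem_interior
    (zero_mem_interior_line hU hx y))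
  rw [hasDerivWithinAt_iff_tendsto_slope' (by simp)] at this
  refine this.congr fun t => ?_
  simp [slope_def_field, div_eq_inv_mul]

lemma dirDeriv_le_div (hU : IsOpen U) (hh : ConvexOn ℝ U h) (hx : x ∈ U) {y : E} {t : ℝ}
    (ht : 0 < t) (hy : x + t • y ∈ U) : dirDeriv h x y ≤ t⁻¹ * (h (x + t • y) - h x) := by
  have := (convexOn_line hh x y).rightDeriv_le_slope_of_mem_interior
    (zero_mem_interior_line hU hx y) (y := t) hy ht
  simpa [slope_def_field, div_eq_inv_mul, dirDeriv] using this

lemma dirDeriv_zero : dirDeriv h x 0 = 0 := by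
  simp [dirDeriv]

lemma dirDeriv_smul (hU : IsOpen U) (hh : ConvexOn ℝ U h) (hx : x ∈ U) {c : ℝ} (hc : 0 < c)
    (y : E) : dirDeriv h x (c • y) = c * dirDeriv h x y := by
  have h1 := tendsto_dirDeriv hU hh hx (c • y)
  have hmul : Tendsto (fun t : ℝ => t * c) (𝓝[>] 0) (𝓝[>] 0) := by
    refine tendsto_nhdsWithin_of_tendsto_nhds_of_eventually_within _ ?_ ?_
    · have : Tendsto (fun t : ℝ => t * c) (𝓝 0) (𝓝 (0 * c)) :=
        Continuous.tendsto (by fun_prop) 0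
      rw [zero_mul] at this
      exact this.mono_left nhdsWithin_le_nhds
    · filter_upwards [self_mem_nhdsWithin] with t ht using mul_pos ht hc
  have h2 := ((tendsto_dirDeriv hU hh hx y).comp hmul).const_mul c
  refine tendsto_nhds_unique h1 (h2.congr fun t => ?_)
  simp only [Function.comp, smul_smul, mul_inv]
  field_simp

lemma convexOn_dirDeriv (hU : IsOpen U) (hh : ConvexOn ℝ U h) (hx : x ∈ U) :
    ConvexOn ℝ Set.univ (dirDeriv h x) := by
  refine ⟨convex_univ, fun y _ z _ a b ha hb hab => ?_⟩
  refine le_of_tendsto_of_tendsto (tendsto_dirDeriv hU hh hx (a • y + b • z))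
    (((tendsto_dirDeriv hU hh hx y).const_mul a).add
      ((tendsto_dirDeriv hU hh hx z).const_mul b)) ?_
  filter_upwards [self_mem_nhdsWithin, eventually_add_smul_mem hU hx y,
    eventually_add_smul_mem hU hx z] with t ht hy hz
  have h1 := hh.2 hy hz ha hb hab
  have e : a • (x + t • y) + b • (x + t • z) = x + t • (a • y + b • z) := by
    have : x = (a + b) • x := by rw [hab, one_smul]
    conv_rhs => rw [this]
    module
  rw [e] at h1
  simp only [smul_eq_mul] at h1
  have h2 : h (x + t • (a • y + b • z)) - h x
      ≤ a * (h (x + t • y) - h x) + b * (h (x + t • z) - h x) := by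
    have : h x = (a + b) * h x := by rw [hab, one_mul]
    linarith
  have h3 := mul_le_mul_of_nonneg_left h2 (inv_nonneg.2 (le_of_lt ht))
  linarith

lemma measurable_dirDeriv {Sp : Type*} [MeasurableSpace Sp] {h : Sp → E → ℝ} (hU : IsOpen U)
    (hh : ∀ s, ConvexOn ℝ U (h s)) (hx : x ∈ U) (hmeas : ∀ y ∈ U, Measurable fun s => h s y)
    (y : E) : Measurable fun s => dirDeriv (h s) x y := by
  classical
  have ht0 : Tendsto (fun k : ℕ => 1 / ((k : ℝ) + 1)) atTop (𝓝[>] 0) :=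
    tendsto_nhdsWithin_of_tendsto_nhds_of_eventually_within _
      tendsto_one_div_add_atTop_nhds_zero_nat
      (Eventually.of_forall fun k => Set.mem_Ioi.2 Nat.one_div_pos_of_nat)
  obtain ⟨N, hN⟩ := eventually_atTop.1 (ht0.eventually (eventually_add_smul_mem hU hx y))
  refine measurable_of_tendsto_metrizable (f := fun k s =>
    (1 / (((k + N : ℕ) : ℝ) + 1))⁻¹ * (h s (x + (1 / (((k + N : ℕ) : ℝ) + 1)) • y) - h s x))
    (fun k => ((hmeas _ (hN _ (Nat.le_add_left N k))).sub (hmeas x hx)).const_mul _) ?_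
  rw [tendsto_pi_nhds]
  intro s
  exact ((tendsto_dirDeriv hU (hh s) hx y).comp ht0).comp (tendsto_add_atTop_nat N)

/-- A measurable selection of subgradients at `x` that are exposed in a given direction `d`, i.e.
whose inner product with `d` is the directional derivative in that direction. -/
lemma exists_measurable_exposed_subgradient [FiniteDimensional ℝ E] [MeasurableSpace E]
    [BorelSpace E] {Sp : Type*} [MeasurableSpace Sp] {h : Sp → E → ℝ} (hU : IsOpen U)
    (hh : ∀ s, ConvexOn ℝ U (h s)) (hx : x ∈ U) (hmeas : ∀ y ∈ U, Measurable fun s => h s y)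
    (d : E) : ∃ g : Sp → E, Measurable g ∧ (∀ s, ∀ y ∈ U, h s x + inner ℝ (g s) (y - x) ≤ h s y) ∧
      ∀ s, inner ℝ (g s) d = dirDeriv (h s) x d := by
  obtain ⟨g, hg, hsub⟩ := exists_measurable_subgradient
    (fun s => convexOn_dirDeriv hU (hh s) hx) (measurable_dirDeriv hU hh hx hmeas) d
  have hd : ∀ s, inner ℝ (g s) d = dirDeriv (h s) x d := by
    intro s
    have h0 := hsub s 0
    have h2 := hsub s ((2 : ℝ) • d)
    have e : (2 : ℝ) • d - d = d := by module
    rw [dirDeriv_smul hU (hh s) hx two_pos, e] at h2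
    rw [dirDeriv_zero, zero_sub, inner_neg_right] at h0
    linarith
  refine ⟨g, hg, fun s y hy => ?_, hd⟩
  have h1 := hsub s (y - x)
  have h2 := dirDeriv_le_div hU (hh s) hx (y := y - x) one_pos (by simpa using hy)
  rw [inner_sub_right, hd] at h1
  simp only [one_smul, inv_one, one_mul, add_sub_cancel] at h2
  linarith

end InnerProduct

/-! ### Convexity and lower semicontinuity of the population objective -/

/-- A nonempty convex set has a point `a` (in its relative interior) such that every bounded part of
the set can be reflected through `a`, with a small ratio `t`, into a fixed finitely generated
convex subset: `(1 + t) a - t y` is a convex combination of the points `q i`. -/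
lemma exists_reflection_mem_convexHull {E : Type*} [NormedAddCommGroup E] [NormedSpace ℝ E]
    [FiniteDimensional ℝ E] {X : Set E} (hX : Convex ℝ X) (hne : X.Nonempty) (R : ℝ) :
    ∃ (ι : Type) (_ : Fintype ι) (q : ι → E) (a : E) (t : ℝ), (∀ i, q i ∈ X) ∧ a ∈ X ∧ 0 < t ∧
      ∀ y ∈ X, ‖y‖ ≤ R → ∃ c : ι → ℝ, (∀ i, 0 ≤ c i) ∧ ∑ i, c i = 1 ∧
        (1 + t) • a = t • y + ∑ i, c i • q i := by
  obtain ⟨x₀, hx₀⟩ := hne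
  obtain ⟨b, hbs, hbspan, hbli⟩ := exists_linearIndependent ℝ ((fun y => y - x₀) '' X)
  have hbfin : Finite b := hbli.setFinite
  obtain ⟨n, ⟨eb⟩⟩ := Finite.exists_equiv_fin b
  let v : Fin n → E := fun i => (eb.symm i : E)
  have hvli : LinearIndependent ℝ v := hbli.comp _ eb.symm.injective
  have hvr : Set.range v = b := by
    ext z; constructor
    · rintro ⟨i, rfl⟩; exact (eb.symm i).2
    · intro hz; exact ⟨eb ⟨z, hz⟩, by simp [v]⟩
  have hvX : ∀ i, x₀ + v i ∈ X := by
    intro i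
    obtain ⟨y, hy, hyv⟩ := hbs (eb.symm i).2
    have : x₀ + v i = y := by simp only [v]; rw [← hyv]; exact add_sub_cancel x₀ y
    rw [this]; exact hy
  let B := Module.Basis.span hvli
  obtain ⟨C, hC⟩ : ∃ C : ℝ, ∀ (w : Submodule.span ℝ (Set.range v)) (i : Fin n),
      |B.repr w i| ≤ C * ‖w‖ := by
    let T := LinearMap.toContinuousLinearMap B.equivFun.toLinearMap
    refine ⟨‖T‖, fun w i => ?_⟩
    exact (norm_le_pi_norm (T w) i).trans (T.le_opNorm w)
  let K : ℝ := |C| * (|R| + ‖x₀‖)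
  have hK0 : 0 ≤ K := by positivity
  let N : ℝ := (n : ℝ) + 1
  have hN0 : 0 < N := by positivity
  -- The barycentre has all weights `N⁻¹`; a perturbation of size `t` in coordinates bounded by `K`
  -- keeps the weights nonnegative.
  let t : ℝ := 1 / (N ^ 2 * (K + 1))
  have ht0 : 0 < t := by positivity
  have htN : t * (N ^ 2 * (K + 1)) = 1 := by simp only [t]; field_simp
  let q : Option (Fin n) → E := fun o => o.elim x₀ fun i => x₀ + v i
  have hq : ∀ o, q o ∈ X := by rintro (_ | i); exacts [hx₀, hvX i]
  have hsumN : ∑ _o : Option (Fin n), N⁻¹ = 1 := by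
    simp [N]; field_simp
  refine ⟨Option (Fin n), inferInstance, q, ∑ o, N⁻¹ • q o, t, hq, ?_, ht0, ?_⟩
  · exact hX.sum_mem (fun _ _ => by positivity) hsumN fun o _ => hq o
  intro y hy hyR
  have hw : y - x₀ ∈ Submodule.span ℝ (Set.range v) := by
    rw [hvr, hbspan]; exact Submodule.subset_span ⟨y, hy, rfl⟩
  let al : Fin n → ℝ := fun i => B.repr ⟨y - x₀, hw⟩ i
  have hal : ∀ i, |al i| ≤ K := by
    intro i
    refine (hC ⟨y - x₀, hw⟩ i).trans ?_
    have h1 : ‖(⟨y - x₀, hw⟩ : Submodule.span ℝ (Set.range v))‖ ≤ |R| + ‖x₀‖ :=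
      (norm_sub_le _ _).trans (by gcongr; exact hyR.trans (le_abs_self R))
    exact mul_le_mul (le_abs_self C) h1 (norm_nonneg _) (abs_nonneg C)
  have hyal : y = x₀ + ∑ i, al i • v i := by
    have h1 := congrArg (Subtype.val) (B.sum_repr ⟨y - x₀, hw⟩)
    have h2 : ∑ i, al i • v i = y - x₀ := by
      simpa [B, al, Module.Basis.span_apply] using h1
    rw [h2]; abel
  have hsum_le : |∑ i, al i| ≤ n * K := by
    refine (Finset.abs_sum_le_sum_abs _ _).trans ?_
    refine (Finset.sum_le_sum fun i _ => hal i).trans ?_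
    simp
  have hNinv : N⁻¹ = t * (N * (K + 1)) :=
    (eq_inv_of_mul_eq_one_left (by linear_combination htN)).symm
  have hn : (n : ℝ) = N - 1 := by simp [N]
  have hN1 : 1 ≤ N := by simp [N]
  refine ⟨fun o => o.elim ((1 + t) * N⁻¹ - t + t * ∑ i, al i) fun i => (1 + t) * N⁻¹ - t * al i,
    ?_, ?_, ?_⟩
  · rintro (_ | i)
    · have h1 : t * (-(n * K)) ≤ t * ∑ i, al i :=
        mul_le_mul_of_nonneg_left (abs_le.1 hsum_le).1 ht0.le
      have h2 : 0 ≤ t * N⁻¹ := by positivity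
      simp only [Option.elim]
      have h3 : 0 ≤ t * (K * 1) := by positivity
      rw [hn] at h1
      have h4 : 0 ≤ t * (N - 1) := mul_nonneg ht0.le (by linarith)
      have h5 : N⁻¹ = t * (N * K) + t * N := by rw [hNinv]; ring
      have h6 : (1 + t) * N⁻¹ = t * (N * K) + t * N + t * N⁻¹ := by
        rw [add_mul, one_mul]; linarith
      linarith
    · have h1 : t * al i ≤ t * K := mul_le_mul_of_nonneg_left ((le_abs_self _).trans (hal i)) ht0.le
      have h2 : 0 ≤ t * N⁻¹ := by positivity
      have h4 : t * K ≤ t * (N * (K + 1)) := by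
        apply mul_le_mul_of_nonneg_left _ ht0.le; nlinarith
      simp only [Option.elim]
      linarith
  · rw [Fintype.sum_option]
    simp only [Option.elim, Finset.sum_sub_distrib, ← Finset.mul_sum, Finset.sum_const,
      Finset.card_univ, Fintype.card_fin, nsmul_eq_mul]
    rw [hn]
    field_simp
    ring
  · rw [hyal]
    simp only [Fintype.sum_option, q, Option.elim, smul_add, Finset.sum_add_distrib, sub_smul,
      Finset.sum_sub_distrib, ← Finset.sum_smul, Finset.smul_sum, smul_smul, Finset.sum_const,
      Finset.card_univ, Fintype.card_fin]
    rw [← Nat.cast_smul_eq_nsmul ℝ, hn]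
    have e : (1 + t) * N⁻¹ * N = 1 + t := by field_simp
    rw [← Finset.mul_sum]
    match_scalars
    all_goals (field_simp; try ring)

/-- Convex integrands that are integrable at each point of a convex set are bounded below on
bounded parts of it by an integrable function. -/
lemma exists_integrable_minorant {E Sp : Type*} [NormedAddCommGroup E] [NormedSpace ℝ E]
    [FiniteDimensional ℝ E] [MeasurableSpace Sp] {P : Measure Sp} {X : Set E} (hX : Convex ℝ X)
    {h : Sp → E → ℝ} (hh : ∀ s, ConvexOn ℝ X (h s))
    (hint : ∀ y ∈ X, Integrable (fun s => h s y) P) (R : ℝ) :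
    ∃ M : Sp → ℝ, Integrable M P ∧ ∀ s, ∀ y ∈ X, ‖y‖ ≤ R → M s ≤ h s y := by
  rcases X.eq_empty_or_nonempty with rfl | hne
  · exact ⟨fun _ => 0, integrable_zero _ _ _, fun s y hy => hy.elim⟩
  obtain ⟨ι, _, q, a, t, hq, ha, ht, hrefl⟩ := exists_reflection_mem_convexHull hX hne R
  refine ⟨fun s => t⁻¹ * ((1 + t) * h s a - ∑ i, |h s (q i)|),
    (((hint a ha).const_mul _).sub
      (integrable_finsetSum _ fun i _ => (hint _ (hq i)).abs)).const_mul _, fun s y hy hyR => ?_⟩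
  obtain ⟨c, hc0, hc1, hca⟩ := hrefl y hy hyR
  set z := ∑ i, c i • q i with hz
  have hzX : z ∈ X := hX.sum_mem (fun i _ => hc0 i) hc1 fun i _ => hq i
  have hhz : h s z ≤ ∑ i, |h s (q i)| := by
    refine ((hh s).map_sum_le (fun i _ => hc0 i) hc1 fun i _ => hq i).trans ?_
    refine Finset.sum_le_sum fun i _ => ?_
    have hci : c i ≤ 1 := hc1 ▸ Finset.single_le_sum (fun j _ => hc0 j) (Finset.mem_univ i)
    calc c i • h s (q i) ≤ c i * |h s (q i)| := mul_le_mul_of_nonneg_left (le_abs_self _) (hc0 i)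
      _ ≤ 1 * |h s (q i)| := by gcongr
      _ = _ := one_mul _
  have h1t : 0 < 1 + t := by linarith
  have ha' : a = (t / (1 + t)) • y + (1 / (1 + t)) • z := by
    have : a = (1 / (1 + t)) • ((1 + t) • a) := by
      rw [smul_smul, one_div, inv_mul_cancel₀ h1t.ne', one_smul]
    rw [this, hca, smul_add, smul_smul]
    congr 2
    ring
  have h1 := (hh s).2 hy hzX (show 0 ≤ t / (1 + t) by positivity)
    (show 0 ≤ 1 / (1 + t) by positivity) (by field_simp; ring)
  rw [← ha'] at h1
  simp only [smul_eq_mul] at h1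
  have h2 : (1 + t) * h s a ≤ t * h s y + h s z := by
    have := mul_le_mul_of_nonneg_left h1 h1t.le
    have e : (1 + t) * (t / (1 + t) * h s y + 1 / (1 + t) * h s z) = t * h s y + h s z := by
      field_simp
    linarith
  rw [inv_mul_le_iff₀ ht]
  linarith

section Population

variable {E Sp : Type*} [NormedAddCommGroup E] [MeasurableSpace Sp]
  {P : Measure Sp} {X : Set E} {f : E → Sp → ℝ} {ρ : Sp → ℝ}

lemma convexOn_population_add_sq [NormedSpace ℝ E]
    (hweak : ∀ s, ConvexOn ℝ X fun x => f x s + ρ s / 2 * ‖x‖ ^ 2)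
    (hX : Convex ℝ X) (hfint : ∀ x ∈ X, Integrable (f x) P) (hρ : Integrable ρ P) :
    ConvexOn ℝ X fun x => population P f x + (∫ s, ρ s ∂P) / 2 * ‖x‖ ^ 2 := by
  have hint : ∀ x ∈ X, Integrable (fun s => f x s + ρ s / 2 * ‖x‖ ^ 2) P := fun x hx =>
    (hfint x hx).add ((hρ.div_const 2).mul_const _)
  have heq : ∀ x ∈ X, ∫ s, (f x s + ρ s / 2 * ‖x‖ ^ 2) ∂P
      = population P f x + (∫ s, ρ s ∂P) / 2 * ‖x‖ ^ 2 := by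
    intro x hx
    rw [integral_add (hfint x hx) ((hρ.div_const 2).mul_const _), integral_mul_const,
      integral_div, population]
  refine ⟨hX, fun x hx y hy a b ha hb hab => ?_⟩
  simp only [← heq x hx, ← heq y hy, ← heq _ (hX hx hy ha hb hab), smul_eq_mul]
  rw [← integral_const_mul, ← integral_const_mul, ← integral_add ((hint x hx).const_mul a)
    ((hint y hy).const_mul b)]
  exact integral_mono (hint _ (hX hx hy ha hb hab))
    (((hint x hx).const_mul a).add ((hint y hy).const_mul b))
    fun s => (hweak s).2 hx hy ha hb hab

/-- Fatou's lemma, with the integrable minorant supplied by convexity. -/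
lemma lowerSemicontinuousOn_population [NormedSpace ℝ E] [FiniteDimensional ℝ E]
    (hweak : ∀ s, ConvexOn ℝ X fun x => f x s + ρ s / 2 * ‖x‖ ^ 2) (hX : Convex ℝ X)
    (hcont : ∀ s, ContinuousOn (fun x => f x s) X)
    (hfint : ∀ x ∈ X, Integrable (f x) P) (hρ : Integrable ρ P) :
    LowerSemicontinuousOn (population P f) X := by
  intro x hx c hc
  by_contra hcon
  rw [not_eventually] at hcon
  obtain ⟨y, hy, hyc⟩ := exists_seq_forall_of_frequently (hcon.and_eventually self_mem_nhdsWithin)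
  have hyx : Tendsto y atTop (𝓝 x) := hy.mono_right nhdsWithin_le_nhds
  obtain ⟨R, hR⟩ := (Metric.isBounded_range_of_tendsto y hyx).exists_norm_le
  have hint : ∀ x ∈ X, Integrable (fun s => f x s + ρ s / 2 * ‖x‖ ^ 2) P := fun x hx =>
    (hfint x hx).add ((hρ.div_const 2).mul_const _)
  obtain ⟨M, hM, hMle⟩ := exists_integrable_minorant hX hweak hint R
  let M' : Sp → ℝ := fun s => M s - |ρ s| / 2 * R ^ 2
  have hM' : Integrable M' P := hM.sub ((hρ.abs.div_const 2).mul_const _)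
  have hlow : ∀ k s, M' s ≤ f (y k) s := by
    intro k s
    have hk : ‖y k‖ ≤ R := hR _ ⟨k, rfl⟩
    have h1 := hMle s (y k) (hyc k).2 hk
    have h2 : ρ s / 2 * ‖y k‖ ^ 2 ≤ |ρ s| / 2 * R ^ 2 := by
      gcongr
      exact le_abs_self _
    simp only [M']
    linarith
  have hlim : ∀ s, Tendsto (fun k => f (y k) s) atTop (𝓝 (f x s)) := fun s =>
    (hcont s x hx).tendsto.comp hy
  have hlowx : ∀ s, M' s ≤ f x s := fun s =>
    ge_of_tendsto (hlim s) (Eventually.of_forall fun k => hlow k s)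
  have hfatou : ∫⁻ s, ENNReal.ofReal (f x s - M' s) ∂P
      ≤ liminf (fun k => ∫⁻ s, ENNReal.ofReal (f (y k) s - M' s) ∂P) atTop := by
    have h1 : ∀ s, ENNReal.ofReal (f x s - M' s)
        = liminf (fun k => ENNReal.ofReal (f (y k) s - M' s)) atTop := fun s =>
      ((ENNReal.continuous_ofReal.tendsto _).comp ((hlim s).sub_const _)).liminf_eq.symm
    simp_rw [h1]
    exact lintegral_liminf_le' fun k =>
      ((hfint _ (hyc k).2).sub hM').aestronglyMeasurable.aemeasurable.ennreal_ofReal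
  have hval : ∀ z ∈ X, (∀ s, M' s ≤ f z s) → ∫⁻ s, ENNReal.ofReal (f z s - M' s) ∂P
      = ENNReal.ofReal (population P f z - ∫ s, M' s ∂P) := by
    intro z hz hzM
    rw [population, ← integral_sub (hfint z hz) hM']
    exact (ofReal_integral_eq_lintegral_ofReal ((hfint z hz).sub hM')
      (Eventually.of_forall fun s => sub_nonneg.2 (hzM s))).symm
  rw [hval x hx hlowx] at hfatou
  have hle : liminf (fun k => ∫⁻ s, ENNReal.ofReal (f (y k) s - M' s) ∂P) atTop
      ≤ ENNReal.ofReal (c - ∫ s, M' s ∂P) := by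
    refine (liminf_le_liminf (Eventually.of_forall fun k => ?_)).trans_eq
      (liminf_const (f := (atTop : Filter ℕ)) _)
    rw [hval _ (hyc k).2 (hlow k)]
    exact ENNReal.ofReal_le_ofReal (sub_le_sub_right (not_lt.1 (hyc k).1) _)
  have h0 : 0 ≤ c - ∫ s, M' s ∂P := by
    have h1 : ∫ s, M' s ∂P ≤ population P f (y 0) :=
      integral_mono hM' (hfint _ (hyc 0).2) (hlow 0)
    have h2 := not_lt.1 (hyc 0).1
    linarith
  have := (ENNReal.ofReal_le_ofReal_iff h0).1 (hfatou.trans hle)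
  linarith

end Population

/-! ### The Moreau envelope -/

lemma moreauEnvelope_eq {E : Type*} [NormedAddCommGroup E] {X : Set E} {F : E → ℝ} {lam : ℝ}
    {x z : E} (hz : z ∈ X)
    (hmin : IsMinOn (fun y => F y + lam / 2 * ‖y - x‖ ^ 2) X z) :
    moreauEnvelope X F lam x = F z + lam / 2 * ‖z - x‖ ^ 2 := by
  have : Nonempty X := ⟨⟨z, hz⟩⟩
  refine le_antisymm (ciInf_le ⟨F z + lam / 2 * ‖z - x‖ ^ 2, ?_⟩ (⟨z, hz⟩ : X))
    (le_ciInf fun y => hmin y.2)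
  rintro _ ⟨y, rfl⟩
  exact hmin y.2

lemma moreauEnvelope_le {E : Type*} [NormedAddCommGroup E] {X : Set E} {F : E → ℝ} {lam : ℝ}
    {x z y : E} (hz : z ∈ X)
    (hmin : IsMinOn (fun y => F y + lam / 2 * ‖y - x‖ ^ 2) X z) (hy : y ∈ X) :
    moreauEnvelope X F lam x ≤ F y + lam / 2 * ‖y - x‖ ^ 2 := by
  rw [moreauEnvelope_eq hz hmin]
  exact hmin hy

section Moreau

variable {E : Type*} [NormedAddCommGroup E] [InnerProductSpace ℝ E]

lemma mem_frechetSubdiff_of_quadratic {D : Set E} {φ : E → ℝ} {x v : E} {K : ℝ}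
    (h : ∀ y ∈ D, φ x + inner ℝ v (y - x) - K * ‖y - x‖ ^ 2 ≤ φ y) :
    v ∈ frechetSubdiff D φ x := by
  intro ε hε
  have hsmall : ∀ᶠ y in 𝓝[D] x, |K| * ‖y - x‖ < ε := by
    have hc : Continuous fun y : E => |K| * ‖y - x‖ := by fun_prop
    have : Tendsto (fun y : E => |K| * ‖y - x‖) (𝓝 x) (𝓝 0) := by
      simpa using hc.tendsto x
    exact (this.mono_left nhdsWithin_le_nhds).eventually (gt_mem_nhds hε)
  filter_upwards [hsmall, self_mem_nhdsWithin] with y hy hyD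
  have h1 := h y hyD
  have h2 : K * ‖y - x‖ ^ 2 ≤ ε * ‖y - x‖ := by
    calc K * ‖y - x‖ ^ 2 ≤ |K| * ‖y - x‖ ^ 2 := by gcongr; exact le_abs_self K
      _ = |K| * ‖y - x‖ * ‖y - x‖ := by ring
      _ ≤ ε * ‖y - x‖ := by gcongr
  linarith

variable {X : Set E} {F : E → ℝ} {lam r : ℝ} {xh : E → E}

/-- The optimality condition `lam (x - z) ∈ ∂F(z)` for the proximal point `z` of `x`. -/
lemma inner_le_of_isMinOn_add_sq {x z y : E}
    (hmin : IsMinOn (fun y => F y + lam / 2 * ‖y - x‖ ^ 2) X z) (hy : y ∈ X) :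
    F z + inner ℝ (lam • (x - z)) (y - z) - lam / 2 * ‖y - z‖ ^ 2 ≤ F y := by
  have h : F z + lam / 2 * ‖z - x‖ ^ 2 ≤ F y + lam / 2 * ‖y - x‖ ^ 2 := hmin hy
  have e : y - x = (y - z) - (x - z) := by abel
  rw [e, norm_sub_sq_real (y - z), norm_sub_rev z x] at h
  rw [real_inner_smul_left, real_inner_comm]
  linarith

lemma prox_lipschitz (hlam : 0 ≤ lam) (hr : r < lam)
    (hF : ConvexOn ℝ X fun y => F y + r / 2 * ‖y‖ ^ 2) (hxh : ∀ x, xh x ∈ X)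
    (hmin : ∀ x, IsMinOn (fun y => F y + lam / 2 * ‖y - x‖ ^ 2) X (xh x)) (x y : E) :
    ‖xh x - xh y‖ ≤ lam / (lam - r) * ‖x - y‖ := by
  have hm : 0 < lam - r := sub_pos.2 hr
  have h1 := add_sq_le_of_isMinOn (strongConvexOn_add_sq hF lam x) (hxh x) (hmin x) (hxh y)
  have h2 := add_sq_le_of_isMinOn (strongConvexOn_add_sq hF lam y) (hxh y) (hmin y) (hxh x)
  have e1 : ∀ a b : E, ‖a - b‖ ^ 2 = ‖a‖ ^ 2 - 2 * inner ℝ a b + ‖b‖ ^ 2 := norm_sub_sq_real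
  have h3 : (lam - r) * ‖xh x - xh y‖ ^ 2 ≤ lam * inner ℝ (xh x - xh y) (x - y) := by
    rw [norm_sub_rev (xh y) (xh x)] at h1
    simp only [inner_sub_left, inner_sub_right]
    rw [e1 (xh x) x, e1 (xh y) x] at h1
    rw [e1 (xh x) y, e1 (xh y) y] at h2
    linarith
  have h4 : (lam - r) * ‖xh x - xh y‖ ^ 2 ≤ lam * (‖xh x - xh y‖ * ‖x - y‖) :=
    h3.trans (mul_le_mul_of_nonneg_left (real_inner_le_norm _ _) hlam)
  rw [div_mul_eq_mul_div, le_div_iff₀ hm]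
  rcases (norm_nonneg (xh x - xh y)).eq_or_lt with h0 | h0
  · rw [← h0]; simp; positivity
  · have : ‖xh x - xh y‖ * (‖xh x - xh y‖ * (lam - r)) ≤ ‖xh x - xh y‖ * (lam * ‖x - y‖) := by
      linarith
    exact le_of_mul_le_mul_left this h0

lemma hasGradientAt_moreauEnvelope [CompleteSpace E] (hlam : 0 ≤ lam) (hr : r < lam)
    (hF : ConvexOn ℝ X fun y => F y + r / 2 * ‖y‖ ^ 2) (hxh : ∀ x, xh x ∈ X)
    (hmin : ∀ x, IsMinOn (fun y => F y + lam / 2 * ‖y - x‖ ^ 2) X (xh x)) (x : E) :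
    HasGradientAt (moreauEnvelope X F lam) (lam • (x - xh x)) x := by
  have hupper : ∀ a b : E, moreauEnvelope X F lam b ≤ moreauEnvelope X F lam a
      + inner ℝ (lam • (a - xh a)) (b - a) + lam / 2 * ‖b - a‖ ^ 2 := by
    intro a b
    refine (moreauEnvelope_le (hxh b) (hmin b) (hxh a)).trans_eq ?_
    rw [moreauEnvelope_eq (hxh a) (hmin a)]
    have e : xh a - b = (xh a - a) - (b - a) := by abel
    have e' : a - xh a = -(xh a - a) := by abel
    rw [e, norm_sub_sq_real, e', smul_neg, inner_neg_left, real_inner_smul_left]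
    ring
  set L := lam / (lam - r) with hL
  have hL0 : 0 ≤ L := div_nonneg hlam (sub_pos.2 hr).le
  rw [hasGradientAt_iff_isLittleO]
  refine Asymptotics.IsBigO.trans_isLittleO (g := fun y => ‖y - x‖ ^ 2) ?_ ?_
  · refine Asymptotics.IsBigO.of_bound (lam / 2 + lam * L) (Eventually.of_forall fun y => ?_)
    rw [Real.norm_of_nonneg (sq_nonneg ‖y - x‖), Real.norm_eq_abs, abs_le]
    have h1 := hupper x y
    have h2 := hupper y x
    have h3 : inner ℝ (lam • (y - xh y)) (x - y)
        = -inner ℝ (lam • (x - xh x)) (y - x) - lam * ‖y - x‖ ^ 2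
          + lam * inner ℝ (xh y - xh x) (y - x) := by
      rw [← real_inner_self_eq_norm_sq]
      simp only [real_inner_smul_left, inner_sub_left, inner_sub_right]
      ring
    have h4 : inner ℝ (xh y - xh x) (y - x) ≤ L * ‖y - x‖ ^ 2 := by
      refine (real_inner_le_norm _ _).trans ?_
      rw [sq, ← mul_assoc]
      gcongr
      exact prox_lipschitz hlam hr hF hxh hmin y x
    have h5 := mul_le_mul_of_nonneg_left h4 hlam
    have h6 : 0 ≤ lam * L * ‖y - x‖ ^ 2 := by positivity
    have h7 : 0 ≤ lam * ‖y - x‖ ^ 2 := by positivity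
    rw [norm_sub_rev x y] at h2
    constructor <;> linarith
  · exact Asymptotics.isLittleO_pow_sub_sub x one_lt_two

end Moreau

/-! ### The expected progress of one step -/

section OneStep

variable {E : Type*} [NormedAddCommGroup E] [InnerProductSpace ℝ E]

/-- The three-point inequality of a model step from `x` to `x'`, combined with the subgradient
inequality of the loss at the comparison point `z`. -/
lemma norm_sub_sq_le_of_isModelStep {X : Set E} {φ : E → ℝ} {r a : ℝ} (ha : 0 < a)
    (hφ : ConvexOn ℝ X fun y => φ y + r / 2 * ‖y‖ ^ 2) {x x' z g : E} (hz : z ∈ X)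
    (hstep : IsModelStep X (fun y => φ y + r / 2 * ‖y - x‖ ^ 2) a x x')
    (hg : ∀ y ∈ X, φ z + inner ℝ g (y - z) - r / 2 * ‖y - z‖ ^ 2 ≤ φ y) :
    ‖x' - z‖ ^ 2 ≤ ‖x - z‖ ^ 2 - ‖x' - x‖ ^ 2
      + 2 * a * (-inner ℝ g (x' - z) + r * ‖x - z‖ ^ 2 + r * inner ℝ (x' - x) (x - z)) := by
  have hmin : IsMinOn (fun y => φ y + (r + 1 / a) / 2 * ‖y - x‖ ^ 2) X x' := by
    refine hstep.2.congr (Eventually.of_forall fun y => ?_) ?_ <;> · simp only; field_simp; ring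
  have h1 := add_sq_le_of_isMinOn (strongConvexOn_add_sq hφ (r + 1 / a) x) hstep.1 hmin hz
  have h2 := hg x' hstep.1
  have e : x' - z = (x' - x) + (x - z) := by abel
  have e3 : ‖x' - z‖ ^ 2 = ‖x' - x‖ ^ 2 + 2 * inner ℝ (x' - x) (x - z) + ‖x - z‖ ^ 2 := by
    rw [e]; exact norm_add_sq_real _ _
  rw [norm_sub_rev z x, norm_sub_rev z x'] at h1
  have h3 : (1 / a) / 2 * ‖x' - z‖ ^ 2 ≤ (1 / a) / 2 * (‖x - z‖ ^ 2 - ‖x' - x‖ ^ 2)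
      + (-inner ℝ g (x' - z) + r / 2 * ‖x' - z‖ ^ 2 + r / 2 * ‖x - z‖ ^ 2
        - r / 2 * ‖x' - x‖ ^ 2) := by linarith
  have h4 : r / 2 * ‖x' - z‖ ^ 2 + r / 2 * ‖x - z‖ ^ 2 - r / 2 * ‖x' - x‖ ^ 2
      = r * ‖x - z‖ ^ 2 + r * inner ℝ (x' - x) (x - z) := by rw [e3]; ring
  have h5 := mul_le_mul_of_nonneg_left h3 (show 0 ≤ 2 * a by linarith)
  have h6 : 2 * a * ((1 / a) / 2 * ‖x' - z‖ ^ 2) = ‖x' - z‖ ^ 2 := by field_simp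
  have h7 : 2 * a * ((1 / a) / 2 * (‖x - z‖ ^ 2 - ‖x' - x‖ ^ 2))
      = ‖x - z‖ ^ 2 - ‖x' - x‖ ^ 2 := by field_simp
  have h8 : -inner ℝ g (x' - z) + r / 2 * ‖x' - z‖ ^ 2 + r / 2 * ‖x - z‖ ^ 2
      - r / 2 * ‖x' - x‖ ^ 2
      = -inner ℝ g (x' - z) + r * ‖x - z‖ ^ 2 + r * inner ℝ (x' - x) (x - z) := by linarith
  rw [mul_add, h6, h7, h8] at h5
  exact h5

variable {Sp : Type*} [MeasurableSpace Sp] {P : Measure Sp} {U X : Set E} {f : E → Sp → ℝ}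
  {ρ : Sp → ℝ}

/-- Weak convexity may be centred at any point. -/
lemma convexOn_add_sq_sub {V : Set E} {φ : E → ℝ} {r : ℝ}
    (h : ConvexOn ℝ V fun y => φ y + r / 2 * ‖y‖ ^ 2) (z : E) :
    ConvexOn ℝ V fun y => φ y + r / 2 * ‖y - z‖ ^ 2 := by
  simpa using strongConvexOn_add_sq h r z

/-- A measurable selection of Fréchet subgradients of the losses that realizes the directional
derivative in the direction `d`. -/
lemma exists_measurable_selection [FiniteDimensional ℝ E] [MeasurableSpace E] [BorelSpace E]
    (hU : IsOpen U) (hfmeas : ∀ x ∈ U, Measurable (f x)) (hρ : Measurable ρ)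
    (hweak : ∀ s, ConvexOn ℝ U fun x => f x s + ρ s / 2 * ‖x‖ ^ 2) {z : E} (hz : z ∈ U) (d : E) :
    ∃ g : Sp → E, Measurable g ∧ (∀ s, g s ∈ frechetSubdiff U (fun y => f y s) z) ∧
      (∀ s, ∀ y ∈ U, f z s + inner ℝ (g s) (y - z) - ρ s / 2 * ‖y - z‖ ^ 2 ≤ f y s) ∧
      ∀ s, inner ℝ (g s) d = dirDeriv (fun y => f y s + ρ s / 2 * ‖y - z‖ ^ 2) z d := by
  obtain ⟨g, hg, hsub, hd⟩ := exists_measurable_exposed_subgradient hU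
    (fun s => convexOn_add_sq_sub (hweak s) z) hz
    (fun y hy => (hfmeas y hy).add ((hρ.div_const 2).mul_const _)) d
  have hq : ∀ s, ∀ y ∈ U, f z s + inner ℝ (g s) (y - z) - ρ s / 2 * ‖y - z‖ ^ 2 ≤ f y s := by
    intro s y hy
    have := hsub s y hy
    simp only [sub_self, norm_zero] at this
    linarith
  exact ⟨g, hg, fun s => mem_frechetSubdiff_of_quadratic (hq s), hq, hd⟩

/-- Passage from the `[0, ∞]`-valued variance to Bochner integrals; a finite variance also forces
square integrability, so that the mean in its definition is genuine. -/
lemma memLp_two_of_vecVariance_le [FiniteDimensional ℝ E] [MeasurableSpace E] [BorelSpace E]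
    [IsProbabilityMeasure P] {g : Sp → E} (hg : Measurable g) {V : ℝ} (hV : 0 ≤ V)
    (h : vecVariance P g ≤ ENNReal.ofReal V) :
    MemLp g 2 P ∧ ∫ s, ‖g s - ∫ t, g t ∂P‖ ^ 2 ∂P ≤ V := by
  have : SecondCountableTopology E := secondCountable_of_proper (α := E)
  set c := ∫ t, g t ∂P
  have hm : AEStronglyMeasurable (fun s => g s - c) P := (hg.sub_const c).aestronglyMeasurable
  have hL : MemLp (fun s => g s - c) 2 P := by
    refine ⟨hm, ?_⟩
    rw [eLpNorm_lt_top_iff_lintegral_rpow_enorm_lt_top two_ne_zero ENNReal.ofNat_ne_top]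
    refine lt_of_le_of_lt (le_of_eq ?_) (h.trans_lt ENNReal.ofReal_lt_top)
    simp [vecVariance, c]
  refine ⟨?_, ?_⟩
  · have := hL.add (memLp_const c)
    refine this.congr_norm hg.aestronglyMeasurable (Eventually.of_forall fun s => ?_)
    simp
  · rw [integral_eq_lintegral_of_nonneg_ae (Eventually.of_forall fun s => sq_nonneg _)
      (hm.norm.pow 2)]
    refine ENNReal.toReal_le_of_le_ofReal hV (le_of_eq_of_le ?_ h)
    rw [vecVariance]
    refine lintegral_congr fun s => ?_
    rw [ENNReal.ofReal_pow (norm_nonneg _), ofReal_norm]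

lemma integral_inner_const [CompleteSpace E] {g : Sp → E} (hg : Integrable g P) (d : E) :
    ∫ s, inner ℝ (g s) d ∂P = inner ℝ (∫ s, g s ∂P) d := by
  simp_rw [real_inner_comm d]
  exact integral_inner hg d

/-- The mean of a selection that realizes the directional derivatives in the direction `d` is
at least as steep in that direction as any subgradient of the constrained objective. -/
lemma inner_le_inner_integral_of_dirDeriv [CompleteSpace E]
    (hU : IsOpen U) (hXU : X ⊆ U) (hX : Convex ℝ X)
    (hweak : ∀ s, ConvexOn ℝ U fun x => f x s + ρ s / 2 * ‖x‖ ^ 2)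
    (hfint : ∀ x ∈ X, Integrable (f x) P) (hρ : Integrable ρ P) {z d v : E} {K : ℝ} (hz : z ∈ X)
    (hzd : z + d ∈ X)
    (hv : ∀ y ∈ X, population P f z + inner ℝ v (y - z) - K * ‖y - z‖ ^ 2 ≤ population P f y)
    {g : Sp → E} (hgint : Integrable g P)
    (hg : ∀ s, inner ℝ (g s) d = dirDeriv (fun y => f y s + ρ s / 2 * ‖y - z‖ ^ 2) z d) :
    inner ℝ v d ≤ inner ℝ (∫ s, g s ∂P) d := by
  let t : ℕ → ℝ := fun k => 1 / ((k : ℝ) + 1)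
  have ht : ∀ k, 0 < t k := fun k => Nat.one_div_pos_of_nat
  have ht1 : ∀ k, t k ≤ 1 := fun k => by
    simp only [t]; rw [div_le_one (by positivity)]; linarith [(Nat.cast_nonneg k : (0 : ℝ) ≤ k)]
  have ht0 : Tendsto t atTop (𝓝 0) := tendsto_one_div_add_atTop_nhds_zero_nat
  have ht0' : Tendsto t atTop (𝓝[>] 0) := tendsto_nhdsWithin_of_tendsto_nhds_of_eventually_within _
    ht0 (Eventually.of_forall ht)
  let h : Sp → E → ℝ := fun s y => f y s + ρ s / 2 * ‖y - z‖ ^ 2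
  have hh : ∀ s, ConvexOn ℝ U (h s) := fun s => convexOn_add_sq_sub (hweak s) z
  have hhint : ∀ y ∈ X, Integrable (fun s => h s y) P := fun y hy =>
    (hfint y hy).add ((hρ.div_const 2).mul_const _)
  have hseg : ∀ k, z + t k • d ∈ X := by
    intro k
    have := hX hz hzd (sub_nonneg.2 (ht1 k)) (ht k).le (by ring)
    have e : (1 - t k) • z + t k • (z + d) = z + t k • d := by module
    rwa [e] at this
  let q : ℕ → Sp → ℝ := fun k s => (t k)⁻¹ * (h s (z + t k • d) - h s z)
  have hqint : ∀ k, Integrable (q k) P := fun k =>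
    ((hhint _ (hseg k)).sub (hhint z hz)).const_mul _
  have hqle : ∀ k s, q k s ≤ h s (z + d) - h s z := by
    intro k s
    have := (hh s).2 (hXU hz) (hXU hzd) (sub_nonneg.2 (ht1 k)) (ht k).le (by ring)
    have e : (1 - t k) • z + t k • (z + d) = z + t k • d := by module
    rw [e] at this
    simp only [smul_eq_mul] at this
    simp only [q]
    rw [inv_mul_le_iff₀ (ht k)]
    linarith
  have hgle : ∀ k s, inner ℝ (g s) d ≤ q k s := fun k s => by
    rw [hg]; exact dirDeriv_le_div hU (hh s) (hXU hz) (ht k) (hXU (hseg k))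
  have hgd : Integrable (fun s => inner ℝ (g s) d) P := hgint.inner_const d
  have hlim : Tendsto (fun k => ∫ s, q k s ∂P) atTop (𝓝 (∫ s, inner ℝ (g s) d ∂P)) := by
    refine tendsto_integral_of_dominated_convergence
      (fun s => |inner ℝ (g s) d| + |h s (z + d) - h s z|)
      (fun k => (hqint k).aestronglyMeasurable)
      (hgd.abs.add ((hhint _ hzd).sub (hhint z hz)).abs) (fun k => Eventually.of_forall fun s => ?_)
      (Eventually.of_forall fun s => ?_)
    · have h1 := hqle k s
      have h2 := hgle k s
      rw [Real.norm_eq_abs, abs_le]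
      constructor
      · linarith [neg_abs_le (inner ℝ (g s) d : ℝ), abs_nonneg (h s (z + d) - h s z)]
      · linarith [le_abs_self (h s (z + d) - h s z), abs_nonneg (inner ℝ (g s) d : ℝ)]
    · rw [hg]
      exact (tendsto_dirDeriv hU (hh s) (hXU hz) d).comp ht0'
  have hval : ∀ k, inner ℝ v d + t k * ((∫ s, ρ s ∂P) / 2 * ‖d‖ ^ 2 - K * ‖d‖ ^ 2)
      ≤ ∫ s, q k s ∂P := by
    intro k
    have h1 := hv _ (hseg k)
    have e1 : ∫ s, q k s ∂P = (t k)⁻¹ * (population P f (z + t k • d) - population P f z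
        + (∫ s, ρ s ∂P) / 2 * (t k ^ 2 * ‖d‖ ^ 2)) := by
      simp only [q, h]
      have hi : ∀ y : E, Integrable (fun s => ρ s / 2 * ‖y - z‖ ^ 2) P := fun y =>
        (hρ.div_const 2).mul_const _
      rw [integral_const_mul, integral_sub (hhint _ (hseg k)) (hhint z hz),
        integral_add (hfint _ (hseg k)) (hi _), integral_add (hfint z hz) (hi z),
        integral_mul_const, integral_mul_const, integral_div, population, population]
      simp only [sub_self, norm_zero, add_sub_cancel_left, norm_smul, Real.norm_of_nonneg (ht k).le]
      ring
    rw [add_sub_cancel_left, inner_smul_right, norm_smul, Real.norm_of_nonneg (ht k).le] at h1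
    rw [e1, le_inv_mul_iff₀ (ht k)]
    linarith
  have hlim2 : Tendsto (fun k => inner ℝ v d + t k * ((∫ s, ρ s ∂P) / 2 * ‖d‖ ^ 2 - K * ‖d‖ ^ 2))
      atTop (𝓝 (inner ℝ v d)) := by
    simpa using (ht0.mul_const ((∫ s, ρ s ∂P) / 2 * ‖d‖ ^ 2 - K * ‖d‖ ^ 2)).const_add
      (inner ℝ v d)
  have := le_of_tendsto_of_tendsto' hlim2 hlim hval
  rwa [integral_inner_const hgint d] at this

/-- Completing the square in the step `e`. The vector `m` replaces the mean `c` of the subgradient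
`g`. -/
lemma step_bound_complete_square {x x' z g c m : E} {a r : ℝ} (ha : 0 < a)
    (h : ‖x' - z‖ ^ 2 ≤ ‖x - z‖ ^ 2 - ‖x' - x‖ ^ 2
      + 2 * a * (-inner ℝ g (x' - z) + r * ‖x - z‖ ^ 2 + r * inner ℝ (x' - x) (x - z))) :
    ‖x' - z‖ ^ 2 ≤ ‖x - z‖ ^ 2 + 2 * a * inner ℝ (m - c) (x' - z)
      - 2 * a * inner ℝ (g - c + m) (x - z)
      + 2 * a * (r * ‖x - z‖ ^ 2)
      + 2 * a ^ 2 * (r ^ 2 * ‖x - z‖ ^ 2 + 2 * ‖g - c‖ ^ 2 + 2 * ‖m‖ ^ 2) := by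
  set w := g - c + m with hw
  set d := x - z
  set e := x' - x
  have hxz : x' - z = e + d := by simp only [d, e]; abel
  have h1 : inner ℝ g (x' - z) = inner ℝ w (e + d) - inner ℝ (m - c) (x' - z) := by
    rw [← hxz, ← inner_sub_left]; congr 1; rw [hw]; abel
  have h2 : 0 ≤ ‖e - a • (r • d - w)‖ ^ 2 := sq_nonneg _
  rw [norm_sub_sq_real, norm_smul, Real.norm_of_nonneg ha.le, inner_smul_right, inner_sub_right,
    inner_smul_right, mul_pow] at h2
  have h3 : ‖r • d - w‖ ^ 2 ≤ 2 * (r ^ 2 * ‖d‖ ^ 2 + ‖w‖ ^ 2) := by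
    have := parallelogram_law_with_norm ℝ (r • d) w
    have e1 : ‖r • d‖ ^ 2 = r ^ 2 * ‖d‖ ^ 2 := by rw [norm_smul, mul_pow, Real.norm_eq_abs, sq_abs]
    nlinarith [sq_nonneg ‖r • d + w‖]
  have h4 : ‖w‖ ^ 2 ≤ 2 * ‖g - c‖ ^ 2 + 2 * ‖m‖ ^ 2 := by
    have := parallelogram_law_with_norm ℝ (g - c) m
    nlinarith [sq_nonneg ‖g - c - m‖]
  have h5 : a ^ 2 * ‖r • d - w‖ ^ 2
      ≤ 2 * a ^ 2 * (r ^ 2 * ‖d‖ ^ 2 + 2 * ‖g - c‖ ^ 2 + 2 * ‖m‖ ^ 2) := by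
    have := mul_le_mul_of_nonneg_left (h3.trans (by linarith : _ ≤
      2 * (r ^ 2 * ‖d‖ ^ 2 + 2 * ‖g - c‖ ^ 2 + 2 * ‖m‖ ^ 2))) (sq_nonneg a)
    linarith
  rw [h1, inner_add_right] at h
  rw [real_inner_comm w e] at h2
  linarith

/-- The expected squared distance to a point `z ∈ X` after one model step from `x`. Here `v` is any
(proximal) subgradient at `z` of the constrained objective, and `V` bounds the variance of all
measurable selections of subgradients of the losses at `z`.

The mean `c` of a selection need not be `v`. But if the selection realizes the directional
derivatives in the direction of the mean displacement `E[T] - z`, then `⟪v - c, E[T] - z⟫ ≤ 0`,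
so that `c` may be exchanged for `v` under the expectation; only the variance of the selection
enters the quadratic term. -/
lemma integral_norm_sub_sq_le [FiniteDimensional ℝ E] [MeasurableSpace E] [BorelSpace E]
    [IsProbabilityMeasure P] (hU : IsOpen U) (hXU : X ⊆ U) (hXc : IsClosed X) (hX : Convex ℝ X)
    (hfmeas : ∀ x ∈ U, Measurable (f x)) (hρm : Measurable ρ)
    (hweak : ∀ s, ConvexOn ℝ U fun x => f x s + ρ s / 2 * ‖x‖ ^ 2)
    (hfint : ∀ x ∈ X, Integrable (f x) P) (hρ : MemLp ρ 2 P) {x z v : E} {K V a : ℝ} (hz : z ∈ X)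
    (hv : ∀ y ∈ X, population P f z + inner ℝ v (y - z) - K * ‖y - z‖ ^ 2 ≤ population P f y)
    (hV0 : 0 ≤ V) (hV : ∀ g : Sp → E, Measurable g →
      (∀ s, g s ∈ frechetSubdiff U (fun y => f y s) z) → vecVariance P g ≤ ENNReal.ofReal V)
    (ha : 0 < a) {T : Sp → E} (hTm : Measurable T)
    (hT : ∀ s, IsModelStep X (proxModel f ρ x s) a x (T s)) :
    Integrable (fun s => ‖T s - z‖ ^ 2) P ∧
      ∫ s, ‖T s - z‖ ^ 2 ∂P ≤ ‖x - z‖ ^ 2 - 2 * a * inner ℝ v (x - z)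
        + 2 * a * ((∫ s, ρ s ∂P) * ‖x - z‖ ^ 2)
        + 2 * a ^ 2 * ((∫ s, ρ s ^ 2 ∂P) * ‖x - z‖ ^ 2 + 2 * V + 2 * ‖v‖ ^ 2) := by
  have : SecondCountableTopology E := secondCountable_of_proper (α := E)
  have hρ1 : Integrable ρ P := hρ.integrable one_le_two
  have hρ2 : Integrable (fun s => ρ s ^ 2) P := hρ.integrable_sq
  have hTX : ∀ s, T s ∈ X := fun s => (hT s).1
  have hstep : ∀ g : Sp → E,
      (∀ s, ∀ y ∈ U, f z s + inner ℝ (g s) (y - z) - ρ s / 2 * ‖y - z‖ ^ 2 ≤ f y s) →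
      ∀ s, ‖T s - z‖ ^ 2 ≤ ‖x - z‖ ^ 2 - ‖T s - x‖ ^ 2 + 2 * a * (-inner ℝ (g s) (T s - z)
        + ρ s * ‖x - z‖ ^ 2 + ρ s * inner ℝ (T s - x) (x - z)) := fun g hg s =>
    norm_sub_sq_le_of_isModelStep ha ((hweak s).subset hXU hX) hz (hT s)
      fun y hy => hg s y (hXU hy)
  have hTzm : AEStronglyMeasurable (fun s => ‖T s - z‖ ^ 2) P :=
    (hTm.sub_const z).norm.pow_const 2 |>.aestronglyMeasurable
  have hsq : ∀ g : Sp → E, MemLp g 2 P → Integrable (fun s => ‖g s - ∫ t, g t ∂P‖ ^ 2) P :=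
    fun g hg => (hg.sub (memLp_const _)).integrable_norm_pow two_ne_zero
  -- Any selection shows that the step has a second moment.
  have hTint : Integrable (fun s => ‖T s - z‖ ^ 2) P := by
    obtain ⟨g, hgm, hgsub, hgq, -⟩ :=
      exists_measurable_selection hU hfmeas hρm hweak (hXU hz) (0 : E)
    obtain ⟨hgL, -⟩ := memLp_two_of_vecVariance_le hgm hV0 (hV g hgm hgsub)
    have hg1 : Integrable g P := hgL.integrable one_le_two
    have hbound : Integrable (fun s => ‖x - z‖ ^ 2
        - 2 * a * inner ℝ (g s - (∫ t, g t ∂P) + ∫ t, g t ∂P) (x - z)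
        + 2 * a * (ρ s * ‖x - z‖ ^ 2) + 2 * a ^ 2 * (ρ s ^ 2 * ‖x - z‖ ^ 2
          + 2 * ‖g s - ∫ t, g t ∂P‖ ^ 2 + 2 * ‖∫ t, g t ∂P‖ ^ 2)) P := by
      have i1 : Integrable (fun s => inner ℝ (g s - (∫ t, g t ∂P) + ∫ t, g t ∂P) (x - z)) P :=
        ((hg1.sub (integrable_const _)).add (integrable_const _)).inner_const _
      exact ((((integrable_const _).sub (i1.const_mul _)).add
        ((hρ1.mul_const _).const_mul _)).add ((((hρ2.mul_const _).add
        ((hsq g hgL).const_mul 2)).add (integrable_const _)).const_mul _))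
    refine hbound.mono' hTzm (Eventually.of_forall fun s => ?_)
    rw [Real.norm_of_nonneg (sq_nonneg _)]
    have := step_bound_complete_square (c := ∫ t, g t ∂P) (m := ∫ t, g t ∂P) ha (hstep g hgq s)
    rw [sub_self, inner_zero_left, mul_zero, add_zero] at this
    exact this
  refine ⟨hTint, ?_⟩
  have hTz : Integrable (fun s => T s - z) P := by
    have : MemLp (fun s => T s - z) 2 P :=
      (memLp_two_iff_integrable_sq_norm (hTm.sub_const z).aestronglyMeasurable).2 hTint
    exact this.integrable one_le_two
  have hT1 : Integrable T P :=
    (hTz.add (integrable_const z)).congr (Eventually.of_forall fun s => sub_add_cancel (T s) z)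
  have hmean : z + ∫ s, (T s - z) ∂P ∈ X := by
    rw [integral_sub hT1 (integrable_const _), integral_const, probReal_univ, one_smul,
      add_sub_cancel]
    exact hX.integral_mem hXc (Eventually.of_forall hTX) hT1
  obtain ⟨g, hgm, hgsub, hgq, hgd⟩ :=
    exists_measurable_selection hU hfmeas hρm hweak (hXU hz) (∫ s, (T s - z) ∂P)
  obtain ⟨hgL, hgV⟩ := memLp_two_of_vecVariance_le hgm hV0 (hV g hgm hgsub)
  have hg1 : Integrable g P := hgL.integrable one_le_two
  set c := ∫ t, g t ∂P with hc
  have hsteep : inner ℝ (v - c) (∫ s, (T s - z) ∂P) ≤ 0 := by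
    rw [inner_sub_left, sub_nonpos]
    exact inner_le_inner_integral_of_dirDeriv hU hXU hX hweak hfint hρ1 hz hmean hv hg1 hgd
  have i1 : Integrable (fun s => inner ℝ (g s - c + v) (x - z)) P :=
    ((hg1.sub (integrable_const _)).add (integrable_const _)).inner_const _
  have i2 : Integrable (fun s => inner ℝ (v - c) (T s - z)) P := hTz.const_inner _
  have j0 : Integrable (fun _ : Sp => ‖x - z‖ ^ 2) P := integrable_const _
  have j1 : Integrable (fun s => ‖x - z‖ ^ 2 + 2 * a * inner ℝ (v - c) (T s - z)) P :=
    j0.add (i2.const_mul _)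
  have j2 := j1.sub (i1.const_mul (2 * a))
  have j3 := j2.add ((hρ1.mul_const (‖x - z‖ ^ 2)).const_mul (2 * a))
  have k1 := (hρ2.mul_const (‖x - z‖ ^ 2)).add ((hsq g hgL).const_mul 2)
  have k2 := k1.add (integrable_const (2 * ‖v‖ ^ 2))
  have j4 := j3.add (k2.const_mul (2 * a ^ 2))
  have hle : ∫ s, ‖T s - z‖ ^ 2 ∂P ≤ _ := integral_mono hTint j4 fun s =>
    step_bound_complete_square (c := c) (m := v) ha (hstep g hgq s)
  refine hle.trans ?_
  have e1 : ∫ s, inner ℝ (g s - c + v) (x - z) ∂P = inner ℝ v (x - z) := by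
    have : ∫ s, (g s - c + v) ∂P = v := by
      have hgc : Integrable (fun s => g s - c) P := hg1.sub (integrable_const c)
      rw [integral_add hgc (integrable_const _), integral_sub hg1 (integrable_const _),
        integral_const, integral_const, probReal_univ,
        one_smul, one_smul, ← hc, sub_self, zero_add]
    have hi : Integrable (fun s => g s - c + v) P :=
      (hg1.sub (integrable_const _)).add (integrable_const _)
    rw [integral_inner_const hi, this]
  have e2 : ∫ s, inner ℝ (v - c) (T s - z) ∂P = inner ℝ (v - c) (∫ s, (T s - z) ∂P) :=
    integral_inner hTz _
  rw [integral_add' j3 (k2.const_mul _), integral_add' j2 ((hρ1.mul_const _).const_mul _),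
    integral_sub' j1 (i1.const_mul _), integral_add j0 (i2.const_mul _),
    integral_const_mul, integral_const_mul, integral_const_mul, integral_const_mul,
    integral_add' k1 (integrable_const _), integral_add' (hρ2.mul_const _)
      ((hsq g hgL).const_mul 2), integral_const_mul, integral_mul_const, integral_mul_const,
    e1, e2, integral_const, integral_const, probReal_univ, one_smul, one_smul]
  have h1 : 2 * a * inner ℝ (v - c) (∫ s, (T s - z) ∂P) ≤ 0 :=
    mul_nonpos_of_nonneg_of_nonpos (by positivity) hsteep
  have h2 : 2 * a ^ 2 * ((∫ s, ρ s ^ 2 ∂P) * ‖x - z‖ ^ 2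
      + 2 * ∫ s, ‖g s - c‖ ^ 2 ∂P + 2 * ‖v‖ ^ 2)
      ≤ 2 * a ^ 2 * ((∫ s, ρ s ^ 2 ∂P) * ‖x - z‖ ^ 2 + 2 * V + 2 * ‖v‖ ^ 2) := by
    gcongr
  linarith

end OneStep

/-! ### Almost supermartingales and independent sampling -/

section RobbinsSiegmund

variable {Ω : Type*} {m0 : MeasurableSpace Ω} {μ : Measure Ω}

/-- The **Robbins–Siegmund theorem**, for deterministic perturbations. The conditional inequality
`E[V (k + 1) | ℱ k] ≤ (1 + a k) V k + b k - D k` is stated through integrals over `ℱ k`-measurable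
sets. Dividing by `∏ (1 + a j)` and adding the accumulated `D` and subtracting the accumulated `b`
turns `V` into a supermartingale that is bounded below. -/
theorem ae_tendsto_and_summable_of_almost_supermartingale [IsProbabilityMeasure μ]
    {ℱ : Filtration ℕ m0} {V D : ℕ → Ω → ℝ} {a b : ℕ → ℝ}
    (hVad : StronglyAdapted ℱ V) (hDad : StronglyAdapted ℱ D)
    (hVint : ∀ k, Integrable (V k) μ) (hDint : ∀ k, Integrable (D k) μ)
    (hV0 : ∀ k ω, 0 ≤ V k ω) (hD0 : ∀ k ω, 0 ≤ D k ω) (ha0 : ∀ k, 0 ≤ a k) (hb0 : ∀ k, 0 ≤ b k)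
    (ha : Summable a) (hb : Summable b)
    (hcond : ∀ k s, MeasurableSet[ℱ k] s →
      ∫ ω in s, V (k + 1) ω ∂μ ≤ ∫ ω in s, ((1 + a k) * V k ω + b k - D k ω) ∂μ) :
    ∀ᵐ ω ∂μ, (∃ l, Tendsto (fun k => V k ω) atTop (𝓝 l)) ∧ Summable fun k => D k ω := by
  let c : ℕ → ℝ := fun k => ∏ j ∈ Finset.range k, (1 + a j)
  have hcs : ∀ k, c (k + 1) = c k * (1 + a k) := fun k => Finset.prod_range_succ _ _
  have hc1 : ∀ k, 1 ≤ c k := by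
    intro k
    induction k with
    | zero => simp [c]
    | succ k ih => rw [hcs]; nlinarith [ha0 k]
  have hc0 : ∀ k, 0 < c k := fun k => zero_lt_one.trans_le (hc1 k)
  have hcmono : Monotone c := monotone_nat_of_le_succ fun k => by
    rw [hcs]; nlinarith [ha0 k, hc0 k]
  have hcle : ∀ k, c k ≤ Real.exp (∑' j, a j) := by
    intro k
    calc c k ≤ ∏ j ∈ Finset.range k, Real.exp (a j) :=
          Finset.prod_le_prod (fun j _ => by linarith [ha0 j])
            fun j _ => by linarith [Real.add_one_le_exp (a j)]
      _ = Real.exp (∑ j ∈ Finset.range k, a j) := (Real.exp_sum _ _).symm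
      _ ≤ Real.exp (∑' j, a j) := Real.exp_le_exp.2 (ha.sum_le_tsum _ fun j _ => ha0 j)
  obtain ⟨cl, hcl⟩ : ∃ cl, Tendsto c atTop (𝓝 cl) :=
    ⟨_, tendsto_atTop_ciSup hcmono ⟨_, by rintro _ ⟨k, rfl⟩; exact hcle k⟩⟩
  let w : ℕ → ℝ := fun k => (c (k + 1))⁻¹
  have hw0 : ∀ k, 0 < w k := fun k => inv_pos.2 (hc0 _)
  have hw1 : ∀ k, w k ≤ 1 := fun k => inv_le_one_of_one_le₀ (hc1 _)
  let N : ℕ → Ω → ℝ := fun k ω => ∑ j ∈ Finset.range k, w j * (D j ω - b j)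
  let M : ℕ → Ω → ℝ := fun k ω => (c k)⁻¹ * V k ω + N k ω
  have hNint : ∀ k, Integrable (N k) μ := fun k =>
    integrable_finsetSum _ fun j _ => ((hDint j).sub (integrable_const _)).const_mul _
  have hMint : ∀ k, Integrable (M k) μ := fun k => ((hVint k).const_mul _).add (hNint k)
  have hNad : ∀ k i, i ≤ k + 1 → StronglyMeasurable[ℱ k] (N i) := by
    intro k i hi
    refine Finset.stronglyMeasurable_fun_sum _ fun j hj => ?_
    have hjk : j ≤ k := by have := Finset.mem_range.1 hj; omega
    exact (((hDad j).mono (ℱ.mono hjk)).sub stronglyMeasurable_const).const_mul _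
  have hMsup : Supermartingale M ℱ μ := by
    refine supermartingale_of_setIntegral_succ_le
      (fun k => ((hVad k).const_mul _).add (hNad k k (Nat.le_succ k))) hMint fun k s hs => ?_
    have hMs : ∀ ω, M (k + 1) ω = w k * V (k + 1) ω + (N k ω + w k * (D k ω - b k)) := by
      intro ω
      simp only [M, N, w, Finset.sum_range_succ]
    have hNs : Integrable (fun ω => N k ω + w k * (D k ω - b k)) μ :=
      (hNint k).add (((hDint k).sub (integrable_const _)).const_mul _)
    have hR : Integrable (fun ω => (1 + a k) * V k ω + b k - D k ω) μ :=
      (((hVint k).const_mul _).add (integrable_const _)).sub (hDint k)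
    have hck : (c k)⁻¹ = w k * (1 + a k) := by
      have h1 : 1 + a k ≠ 0 := by linarith [ha0 k]
      simp only [w]; rw [hcs, mul_inv]; field_simp
    calc ∫ ω in s, M (k + 1) ω ∂μ
        = w k * ∫ ω in s, V (k + 1) ω ∂μ + ∫ ω in s, (N k ω + w k * (D k ω - b k)) ∂μ := by
          simp_rw [hMs]
          rw [integral_add ((hVint _).const_mul _).integrableOn hNs.integrableOn,
            integral_const_mul]
      _ ≤ w k * ∫ ω in s, ((1 + a k) * V k ω + b k - D k ω) ∂μ
            + ∫ ω in s, (N k ω + w k * (D k ω - b k)) ∂μ := by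
          have := mul_le_mul_of_nonneg_left (hcond k s hs) (hw0 k).le
          linarith
      _ = ∫ ω in s, M k ω ∂μ := by
          rw [← integral_const_mul, ← integral_add (hR.const_mul _).integrableOn hNs.integrableOn]
          refine integral_congr_ae (Eventually.of_forall fun ω => ?_)
          simp only [M]
          rw [hck]
          ring
  have hsumb : ∀ k, ∑ j ∈ Finset.range k, w j * b j ≤ ∑' j, b j := fun k =>
    (Finset.sum_le_sum fun j _ => mul_le_of_le_one_left (hb0 j) (hw1 j)).trans
      (hb.sum_le_tsum _ fun j _ => hb0 j)
  set β := ∑' j, b j with hβ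
  have hNeq : ∀ k ω, N k ω = ∑ j ∈ Finset.range k, w j * D j ω - ∑ j ∈ Finset.range k, w j * b j :=
    fun k ω => by simp only [N, mul_sub, Finset.sum_sub_distrib]
  have hMlow : ∀ k ω, -β ≤ M k ω := by
    intro k ω
    have h1 : 0 ≤ ∑ j ∈ Finset.range k, w j * D j ω :=
      Finset.sum_nonneg fun j _ => mul_nonneg (hw0 j).le (hD0 j ω)
    have h2 : 0 ≤ (c k)⁻¹ * V k ω := mul_nonneg (inv_nonneg.2 (hc0 k).le) (hV0 k ω)
    simp only [M]
    rw [hNeq]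
    linarith [hsumb k]
  have hβ0 : 0 ≤ β := tsum_nonneg hb0
  have hbdd : ∀ k, eLpNorm ((-M) k) 1 μ ≤ ((∫ ω, M 0 ω ∂μ + 2 * β).toNNReal : ℝ≥0∞) := by
    intro k
    rw [Pi.neg_apply, eLpNorm_neg, eLpNorm_one_eq_lintegral_enorm,
      ← ofReal_integral_norm_eq_lintegral_enorm (hMint k)]
    refine ENNReal.ofReal_le_ofReal ?_
    have h1 : ∫ ω, M k ω ∂μ ≤ ∫ ω, M 0 ω ∂μ := by
      simpa using hMsup.setIntegral_le (Nat.zero_le k) MeasurableSet.univ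
    calc ∫ ω, ‖M k ω‖ ∂μ ≤ ∫ ω, (M k ω + 2 * β) ∂μ := by
          refine integral_mono (hMint k).norm ((hMint k).add (integrable_const _)) fun ω => ?_
          have := hMlow k ω
          rw [Real.norm_eq_abs]
          exact abs_le.2 ⟨by linarith, by linarith⟩
      _ = ∫ ω, M k ω ∂μ + 2 * β := by
          rw [integral_add (hMint k) (integrable_const _)]; simp
      _ ≤ _ := by linarith
  filter_upwards [hMsup.neg.exists_ae_tendsto_of_bdd hbdd] with ω ⟨l, hl⟩
  have hl' : Tendsto (fun k => M k ω) atTop (𝓝 (-l)) := by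
    simpa using hl.neg
  have hwb : Summable fun j => w j * b j :=
    Summable.of_nonneg_of_le (fun j => mul_nonneg (hw0 j).le (hb0 j))
      (fun j => mul_le_of_le_one_left (hb0 j) (hw1 j)) hb
  obtain ⟨B, hB⟩ := hl'.bddAbove_range
  have hwD : Summable fun j => w j * D j ω := by
    refine summable_of_sum_range_le (c := B + β) (fun j => mul_nonneg (hw0 j).le (hD0 j ω))
      fun k => ?_
    have h1 : M k ω ≤ B := hB ⟨k, rfl⟩
    have h2 : 0 ≤ (c k)⁻¹ * V k ω := mul_nonneg (inv_nonneg.2 (hc0 k).le) (hV0 k ω)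
    simp only [M] at h1
    rw [hNeq] at h1
    linarith [hsumb k]
  refine ⟨⟨cl * (-l - (∑' j, w j * D j ω - ∑' j, w j * b j)), ?_⟩, ?_⟩
  · have hN : Tendsto (fun k => N k ω) atTop (𝓝 (∑' j, w j * D j ω - ∑' j, w j * b j)) := by
      simp_rw [hNeq]
      exact hwD.hasSum.tendsto_sum_nat.sub hwb.hasSum.tendsto_sum_nat
    refine (hcl.mul (hl'.sub hN)).congr fun k => ?_
    simp only [M]
    rw [add_sub_cancel_right, mul_inv_cancel_left₀ (hc0 k).ne']
  · refine Summable.of_nonneg_of_le (fun j => hD0 j ω) (fun j => ?_)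
      (hwD.mul_left (Real.exp (∑' j, a j)))
    rw [← mul_assoc]
    refine le_mul_of_one_le_left (hD0 j ω) ?_
    simp only [w]
    rw [← div_eq_mul_inv, one_le_div (hc0 _)]
    exact hcle _

/-- Integrating out an independent variable `Y`, on an event `A` that is independent of it. -/
lemma setLIntegral_comp_le_of_indep {Ω : Type*} {m m0 : MeasurableSpace Ω}
    {μ : Measure Ω} [IsFiniteMeasure μ] {E Sp : Type*} [MeasurableSpace E] [MeasurableSpace Sp]
    (hm : m ≤ m0) {X : Ω → E} (hX : Measurable[m] X)
    {Y : Ω → Sp} (hY : Measurable Y)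
    (hind : Indep m (MeasurableSpace.comap Y inferInstance) μ) {Φ : E → Sp → ℝ≥0∞}
    (hΦ : Measurable (Function.uncurry Φ)) {ψ : E → ℝ≥0∞}
    (hle : ∀ x, ∫⁻ s, Φ x s ∂(μ.map Y) ≤ ψ x) {A : Set Ω} (hA : MeasurableSet[m] A) :
    ∫⁻ ω in A, Φ (X ω) (Y ω) ∂μ ≤ ∫⁻ ω in A, ψ (X ω) ∂μ := by
  classical
  let ind : Ω → ℝ≥0∞ := A.indicator 1
  have hindm : Measurable[m] ind :=
    Measurable.indicator (m := m) (@measurable_const _ _ _ m 1) hA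
  let Z : Ω → E × ℝ≥0∞ := fun ω => (X ω, ind ω)
  have hZm : Measurable[m] Z := hX.prodMk hindm
  have hZ : Measurable Z := hZm.mono hm le_rfl
  have hZY : IndepFun Z Y μ :=
    (IndepFun_iff_Indep Z Y μ).2 (indep_of_indep_of_le_left hind hZm.comap_le)
  have hmap := hZY.map_prod_eq_prod_map_map hZ.aemeasurable hY.aemeasurable
  have hmul : ∀ G : Ω → ℝ≥0∞, ∫⁻ ω in A, G ω ∂μ = ∫⁻ ω, ind ω * G ω ∂μ := by
    intro G
    rw [← lintegral_indicator (hm _ hA)]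
    refine lintegral_congr fun ω => ?_
    by_cases h : ω ∈ A <;> simp [ind, h]
  have hΨ : Measurable fun p : (E × ℝ≥0∞) × Sp => p.1.2 * Φ p.1.1 p.2 :=
    measurable_fst.snd.mul (hΦ.comp (measurable_fst.fst.prodMk measurable_snd))
  rw [hmul, hmul]
  calc ∫⁻ ω, ind ω * Φ (X ω) (Y ω) ∂μ
      = ∫⁻ p, p.1.2 * Φ p.1.1 p.2 ∂(μ.map fun ω => (Z ω, Y ω)) :=
        (lintegral_map hΨ (hZ.prodMk hY)).symm
    _ = ∫⁻ q, ∫⁻ s, q.2 * Φ q.1 s ∂(μ.map Y) ∂(μ.map Z) := by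
        rw [hmap, lintegral_prod _ hΨ.aemeasurable]
    _ = ∫⁻ ω, ∫⁻ s, ind ω * Φ (X ω) s ∂(μ.map Y) ∂μ := lintegral_map hΨ.lintegral_prod_right' hZ
    _ ≤ ∫⁻ ω, ind ω * ψ (X ω) ∂μ := by
        refine lintegral_mono fun ω => ?_
        have hΦx : Measurable (Φ (X ω)) := hΦ.comp measurable_prodMk_left
        rw [lintegral_const_mul _ hΦx]
        gcongr
        exact hle _

/-- The real-valued form of `setLIntegral_comp_le_of_indep`. -/
lemma setIntegral_comp_le_of_indep {Ω : Type*} {m m0 : MeasurableSpace Ω}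
    {μ : Measure Ω} [IsFiniteMeasure μ] {E Sp : Type*} [MeasurableSpace E] [MeasurableSpace Sp]
    (hm : m ≤ m0) {X : Ω → E} (hX : Measurable[m] X)
    {Y : Ω → Sp} (hY : Measurable Y)
    (hind : Indep m (MeasurableSpace.comap Y inferInstance) μ) {Φ : E → Sp → ℝ}
    (hΦ : Measurable (Function.uncurry Φ)) (hΦ0 : ∀ x s, 0 ≤ Φ x s)
    (hint : ∀ x, Integrable (Φ x) (μ.map Y)) {ψ : E → ℝ}
    (hle : ∀ x, ∫ s, Φ x s ∂(μ.map Y) ≤ ψ x) (hψ : Integrable (fun ω => ψ (X ω)) μ) :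
    Integrable (fun ω => Φ (X ω) (Y ω)) μ ∧ ∀ A, MeasurableSet[m] A →
      ∫ ω in A, Φ (X ω) (Y ω) ∂μ ≤ ∫ ω in A, ψ (X ω) ∂μ := by
  have hψ0 : ∀ x, 0 ≤ ψ x := fun x => (integral_nonneg (hΦ0 x)).trans (hle x)
  have hmeas : Measurable fun ω => Φ (X ω) (Y ω) := hΦ.comp ((hX.mono hm le_rfl).prodMk hY)
  have hl : ∀ A, MeasurableSet[m] A → ∫⁻ ω in A, ENNReal.ofReal (Φ (X ω) (Y ω)) ∂μ
      ≤ ∫⁻ ω in A, ENNReal.ofReal (ψ (X ω)) ∂μ := fun A hA =>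
    setLIntegral_comp_le_of_indep (Φ := fun x s => ENNReal.ofReal (Φ x s))
      (ψ := fun x => ENNReal.ofReal (ψ x)) hm hX hY hind hΦ.ennreal_ofReal (fun x => by
        rw [← ofReal_integral_eq_lintegral_ofReal (hint x) (Eventually.of_forall (hΦ0 x))]
        exact ENNReal.ofReal_le_ofReal (hle x)) hA
  have hΦint : Integrable (fun ω => Φ (X ω) (Y ω)) μ := by
    refine ⟨hmeas.aestronglyMeasurable, ?_⟩
    rw [hasFiniteIntegral_iff_ofReal (Eventually.of_forall fun ω => hΦ0 _ _)]
    refine lt_of_le_of_lt ?_ ((hasFiniteIntegral_iff_ofReal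
      (Eventually.of_forall fun ω => hψ0 (X ω))).1 hψ.2)
    simpa using hl Set.univ MeasurableSet.univ
  refine ⟨hΦint, fun A hA => ?_⟩
  rw [integral_eq_lintegral_of_nonneg_ae (Eventually.of_forall fun ω => hΦ0 _ _)
    hΦint.integrableOn.aestronglyMeasurable,
    integral_eq_lintegral_of_nonneg_ae (Eventually.of_forall fun ω => hψ0 _)
    hψ.integrableOn.aestronglyMeasurable]
  refine ENNReal.toReal_mono ?_ (hl A hA)
  exact ((hasFiniteIntegral_iff_ofReal (Eventually.of_forall fun ω => hψ0 (X ω))).1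
    hψ.integrableOn.2).ne

/-- The past `σ(S 0, …, S (k - 1))` of a sequence of random variables. -/
def pastFiltration {Sp : Type*} [MeasurableSpace Sp] (S : ℕ → Ω → Sp)
    (hS : ∀ k, Measurable (S k)) : Filtration ℕ m0 where
  seq k := ⨆ j ∈ Set.Iio k, MeasurableSpace.comap (S j) inferInstance
  mono' _ _ hkl := biSup_mono fun _ hj => lt_of_lt_of_le hj hkl
  le' _ := iSup₂_le fun j _ => (hS j).comap_le

lemma indep_pastFiltration {Sp : Type*} [MeasurableSpace Sp] {S : ℕ → Ω → Sp}
    (hS : ∀ k, Measurable (S k)) (hind : iIndepFun S μ) (k : ℕ) :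
    Indep (pastFiltration S hS k) (MeasurableSpace.comap (S k) inferInstance) μ := by
  have := indep_iSup_of_disjoint (fun j => (hS j).comap_le) hind (S := Set.Iio k) (T := {k})
    (by simp)
  simpa [pastFiltration] using this

lemma measurable_pastFiltration_succ {Sp : Type*} [MeasurableSpace Sp] {S : ℕ → Ω → Sp}
    (hS : ∀ k, Measurable (S k)) (k : ℕ) : Measurable[pastFiltration S hS (k + 1)] (S k) :=
  measurable_iff_comap_le.2 (le_biSup (fun j => MeasurableSpace.comap (S j) inferInstance)
    (Set.mem_Iio.2 k.lt_succ_self))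

end RobbinsSiegmund

/-! ### The iteration and its Lyapunov function -/

section Iteration

variable {E : Type*} [NormedAddCommGroup E] [InnerProductSpace ℝ E] {Sp : Type*}
  {U X : Set E} {f : E → Sp → ℝ} {ρ : Sp → ℝ}

lemma proxModel_add_eq {E Sp : Type*} [NormedAddCommGroup E] (f : E → Sp → ℝ) (ρ : Sp → ℝ)
    (x : E) (s : Sp) (a : ℝ) (y : E) :
    proxModel f ρ x s y + 1 / (2 * a) * ‖y - x‖ ^ 2
      = f y s + (ρ s + 1 / a) / 2 * ‖y - x‖ ^ 2 := by
  rw [proxModel, one_div, one_div, mul_inv]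
  ring

lemma strongConvexOn_proxModel {s : Sp}
    (hweak : ConvexOn ℝ X fun x => f x s + ρ s / 2 * ‖x‖ ^ 2) (x : E) (a : ℝ) :
    StrongConvexOn X (1 / a) fun y => proxModel f ρ x s y + 1 / (2 * a) * ‖y - x‖ ^ 2 := by
  simp_rw [proxModel_add_eq]
  simpa using strongConvexOn_add_sq hweak (ρ s + 1 / a) x

lemma IsModelStep.unique {s : Sp} (hweak : ConvexOn ℝ X fun x => f x s + ρ s / 2 * ‖x‖ ^ 2)
    {x y y' : E} {a : ℝ} (ha : 0 < a) (hy : IsModelStep X (proxModel f ρ x s) a x y)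
    (hy' : IsModelStep X (proxModel f ρ x s) a x y') : y = y' := by
  have h1 := add_sq_le_of_isMinOn (strongConvexOn_proxModel hweak x a) hy.1 hy.2 hy'.1
  have h2 := isMinOn_iff.1 hy'.2 y hy.1
  have h3 : 1 / a / 2 * ‖y' - y‖ ^ 2 ≤ 0 := by linarith
  have h4 : ‖y' - y‖ ^ 2 ≤ 0 := nonpos_of_mul_nonpos_right h3 (by positivity)
  have h5 : y' - y = 0 := by
    rw [← norm_eq_zero]; exact pow_eq_zero_iff two_ne_zero |>.1 (le_antisymm h4 (sq_nonneg _))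
  exact (sub_eq_zero.1 h5).symm

variable [FiniteDimensional ℝ E]

lemma continuousOn_loss (hU : IsOpen U) {s : Sp}
    (hweak : ConvexOn ℝ U fun x => f x s + ρ s / 2 * ‖x‖ ^ 2) :
    ContinuousOn (fun x => f x s) U := by
  have hc : Continuous fun x : E => ρ s / 2 * ‖x‖ ^ 2 := by fun_prop
  refine ((hweak.continuousOn hU).sub hc.continuousOn).congr fun x _ => ?_
  simp

variable [MeasurableSpace E] [BorelSpace E] [MeasurableSpace Sp] {P : Measure Sp}

/-- The model step as a jointly measurable map, defined for all starting points and samples and not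
just along the iteration. -/
lemma exists_measurable_modelStep (hU : IsOpen U) (hXU : X ⊆ U) (hXc : IsClosed X)
    (hX : Convex ℝ X) (hne : X.Nonempty) (hfmeas : ∀ x ∈ U, Measurable (f x)) (hρ : Measurable ρ)
    (hweak : ∀ s, ConvexOn ℝ U fun x => f x s + ρ s / 2 * ‖x‖ ^ 2) {a : ℝ} (ha : 0 < a) :
    ∃ T : E → Sp → E, Measurable (Function.uncurry T) ∧
      ∀ x s, IsModelStep X (proxModel f ρ x s) a x (T x s) := by
  have : SecondCountableTopology E := secondCountable_of_proper (α := E)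
  have hwX : ∀ s, ConvexOn ℝ X fun x => f x s + ρ s / 2 * ‖x‖ ^ 2 := fun s =>
    (hweak s).subset hXU hX
  have hcont : ∀ x s, ContinuousOn
      (fun y => proxModel f ρ x s y + 1 / (2 * a) * ‖y - x‖ ^ 2) X := by
    intro x s
    simp_rw [proxModel_add_eq]
    have hc : Continuous fun y : E => (ρ s + 1 / a) / 2 * ‖y - x‖ ^ 2 := by fun_prop
    exact ((continuousOn_loss hU (hweak s)).mono hXU).add hc.continuousOn
  choose T hTX hT using fun x s => exists_isMinOn_of_strongConvexOn hXc hne (one_div_pos.2 ha)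
    (strongConvexOn_proxModel (hwX s) x a) (hcont x s).lowerSemicontinuousOn
  refine ⟨T, ?_, fun x s => ⟨hTX x s, hT x s⟩⟩
  refine measurable_of_isMinOn (X := X) (one_div_pos.2 ha)
    (φ := fun p : E × Sp => fun y => proxModel f ρ p.1 p.2 y + 1 / (2 * a) * ‖y - p.1‖ ^ 2)
    (fun y hy => ?_) (fun p => hcont p.1 p.2) (fun p => strongConvexOn_proxModel (hwX p.2) p.1 a)
    (fun p => hTX p.1 p.2) (fun p => hT p.1 p.2)
  have h1 : Measurable fun p : E × Sp => ‖y - p.1‖ ^ 2 :=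
    (measurable_fst.const_sub y).norm.pow_const 2
  exact (((hfmeas y (hXU hy)).comp measurable_snd).add
    (((hρ.comp measurable_snd).div_const 2).mul h1)).add (h1.const_mul _)

/-- One step decreases the Moreau envelope in expectation, up to relative and absolute errors of
second order in the stepsize. The relative error absorbs the part of the second moment that is
proportional to `‖x - xh x‖²`, as `lam / 2 * ‖x - xh x‖²` is at most the envelope above `β`. -/
lemma exists_integral_moreauEnvelope_le [IsProbabilityMeasure P] (hU : IsOpen U) (hXU : X ⊆ U)
    (hXc : IsClosed X) (hX : Convex ℝ X) (hfmeas : ∀ x ∈ U, Measurable (f x)) (hρm : Measurable ρ)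
    (hweak : ∀ s, ConvexOn ℝ U fun x => f x s + ρ s / 2 * ‖x‖ ^ 2)
    (hfint : ∀ x ∈ X, Integrable (f x) P) (hvar : RelativeVariance U X P f) (hρ : MemLp ρ 2 P)
    {lam : ℝ} (hlam0 : 0 ≤ lam) {xh : E → E} (hxh : ∀ x, xh x ∈ X)
    (hmin : ∀ x, IsMinOn (fun y => population P f y + lam / 2 * ‖y - x‖ ^ 2) X (xh x))
    (hmeasM : Measurable (moreauEnvelope X (population P f) lam))
    {β : ℝ} (hβ : ∀ y ∈ X, β ≤ population P f y) :
    ∃ A B : ℝ, 0 ≤ A ∧ 0 ≤ B ∧ ∀ (x : E) (a : ℝ) (T : Sp → E), 0 < a → Measurable T →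
      (∀ s, IsModelStep X (proxModel f ρ x s) a x (T s)) →
      Integrable (fun s => moreauEnvelope X (population P f) lam (T s) - β) P ∧
      ∫ s, (moreauEnvelope X (population P f) lam (T s) - β) ∂P
        ≤ (1 + A * a ^ 2) * (moreauEnvelope X (population P f) lam x - β) + B * a ^ 2
          - a * (lam * (lam - ∫ s, ρ s ∂P) * ‖x - xh x‖ ^ 2) := by
  obtain ⟨C₁, C₂, hC⟩ := hvar
  set F := population P f with hF
  set r := ∫ s, ρ s ∂P
  set q := ∫ s, ρ s ^ 2 ∂P with hq
  have hq0 : 0 ≤ q := integral_nonneg fun s => sq_nonneg _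
  have hMlow : ∀ x, F (xh x) + lam / 2 * ‖x - xh x‖ ^ 2 = moreauEnvelope X F lam x := fun x => by
    rw [moreauEnvelope_eq (hxh x) (hmin x), norm_sub_rev]
  have hMβ : ∀ x, lam / 2 * ‖x - xh x‖ ^ 2 ≤ moreauEnvelope X F lam x - β := fun x => by
    rw [← hMlow]; linarith [hβ _ (hxh x)]
  refine ⟨2 * (q + 2 * |C₁| * lam ^ 2 + 2 * lam ^ 2), 2 * lam * |C₂|, by positivity, by positivity,
    fun x a T ha hTm hT => ?_⟩
  set D := ‖x - xh x‖ ^ 2 with hD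
  have hD0 : 0 ≤ D := sq_nonneg _
  set v := lam • (x - xh x) with hvdef
  have hv2 : ‖v‖ ^ 2 = lam ^ 2 * D := by
    rw [hvdef, norm_smul, mul_pow, Real.norm_eq_abs, sq_abs]
  have hvd : inner ℝ v (x - xh x) = lam * D := by
    rw [hvdef, real_inner_smul_left, real_inner_self_eq_norm_sq]
  have hvq : ∀ y ∈ X, F (xh x) + inner ℝ v (y - xh x) - lam / 2 * ‖y - xh x‖ ^ 2 ≤ F y :=
    fun y hy => inner_le_of_isMinOn_add_sq (hmin x) hy
  have hV0 : 0 ≤ |C₁| * ‖v‖ ^ 2 + |C₂| := by positivity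
  obtain ⟨hint, hle⟩ := integral_norm_sub_sq_le hU hXU hXc hX hfmeas hρm hweak hfint hρ (hxh x)
    hvq hV0 (fun g hg hgs => (hC (xh x) (hxh x) g hg hgs v
      (mem_frechetSubdiff_of_quadratic hvq)).trans (ENNReal.ofReal_le_ofReal (add_le_add
        (mul_le_mul_of_nonneg_right (le_abs_self C₁) (sq_nonneg _)) (le_abs_self C₂)))) ha hTm hT
  have hup : ∀ s, moreauEnvelope X F lam (T s) - β
      ≤ F (xh x) - β + lam / 2 * ‖T s - xh x‖ ^ 2 := by
    intro s
    have := moreauEnvelope_le (hxh (T s)) (hmin (T s)) (hxh x)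
    rw [norm_sub_rev] at this
    linarith
  have hlow : ∀ s, 0 ≤ moreauEnvelope X F lam (T s) - β := fun s =>
    le_trans (by positivity) (hMβ (T s))
  have hupint : Integrable (fun s => F (xh x) - β + lam / 2 * ‖T s - xh x‖ ^ 2) P :=
    (integrable_const _).add (hint.const_mul _)
  have hMint : Integrable (fun s => moreauEnvelope X F lam (T s) - β) P := by
    refine hupint.mono' ((hmeasM.comp hTm).sub_const β).aestronglyMeasurable
      (Eventually.of_forall fun s => ?_)
    rw [Real.norm_of_nonneg (hlow s)]
    exact hup s
  refine ⟨hMint, (integral_mono hMint hupint hup).trans ?_⟩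
  rw [integral_add (integrable_const _) (hint.const_mul _), integral_const, probReal_univ, one_smul,
    integral_const_mul]
  have h1 := mul_le_mul_of_nonneg_left hle (show 0 ≤ lam / 2 by positivity)
  rw [hvd, hv2] at h1
  have h2 := hMlow x
  have h3 : 0 ≤ 2 * (q + 2 * |C₁| * lam ^ 2 + 2 * lam ^ 2) * a ^ 2 := by positivity
  have h4 := mul_le_mul_of_nonneg_left (hMβ x) h3
  linarith

end Iteration

end ModelOpt

theorem mainTheorem2
    {n : ℕ}
    -- the sample space, and the feasible set inside an open convex domain of the losses
    {Sp : Type*} [MeasurableSpace Sp] (P : Measure Sp) [IsProbabilityMeasure P]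
    (U X : Set (EuclideanSpace ℝ (Fin n)))
    (hUopen : IsOpen U) (hUconvex : Convex ℝ U) (hXU : X ⊆ U)
    (hXclosed : IsClosed X) (hXconvex : Convex ℝ X)
    -- the weakly convex losses
    (f : EuclideanSpace ℝ (Fin n) → Sp → ℝ) (ρ : Sp → ℝ)
    (hfmeas : ∀ x ∈ U, Measurable (f x)) (hρmeas : Measurable ρ)
    (hweak : ∀ s, ConvexOn ℝ U (fun x => f x s + ρ s / 2 * ‖x‖ ^ 2))
    (hfint : ∀ x ∈ X, Integrable (f x) P)
    -- the hypotheses of the theorem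
    (hvar : ModelOpt.RelativeVariance U X P f)
    (hρsq : MemLp ρ 2 P)
    (lam : ℝ) (hlam0 : 0 ≤ lam) (hlam : ∫ s, ρ s ∂P < lam)
    (hbdd : BddBelow (ModelOpt.population P f '' X))
    -- positive, square-summable stepsizes
    (α : ℕ → ℝ) (hαpos : ∀ k, 0 < α k) (hαsq : Summable (fun k => α k ^ 2))
    -- the i.i.d. samples and the iterates
    {Ω : Type*} [MeasurableSpace Ω] (μ : Measure Ω) [IsProbabilityMeasure μ]
    (S : ℕ → Ω → Sp) (hSmeas : ∀ k, Measurable (S k))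
    (hSindep : iIndepFun S μ) (hSlaw : ∀ k, μ.map (S k) = P)
    (x : ℕ → Ω → EuclideanSpace ℝ (Fin n)) (x₀ : EuclideanSpace ℝ (Fin n))
    (hx₀ : ∀ ω, x 0 ω = x₀)
    (hstep : ∀ k ω, ModelOpt.IsModelStep X (ModelOpt.proxModel f ρ (x k ω) (S k ω)) (α k)
      (x k ω) (x (k + 1) ω)) :
    Differentiable ℝ (ModelOpt.moreauEnvelope X (ModelOpt.population P f) lam) ∧
    (∃ G : Ω → ℝ, Measurable G ∧
      ∀ᵐ ω ∂μ, Tendsto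
        (fun k => ModelOpt.moreauEnvelope X (ModelOpt.population P f) lam (x k ω))
        atTop (𝓝 (G ω))) ∧
    (∀ᵐ ω ∂μ, Summable (fun k =>
      α k * ‖gradient (ModelOpt.moreauEnvelope X (ModelOpt.population P f) lam) (x k ω)‖ ^ 2)) := by
  open ModelOpt in
  obtain ⟨ω₀⟩ : Nonempty Ω := nonempty_of_isProbabilityMeasure μ
  have hXne : X.Nonempty := ⟨x 1 ω₀, (hstep 0 ω₀).1⟩
  have hweakX : ∀ s, ConvexOn ℝ X fun x => f x s + ρ s / 2 * ‖x‖ ^ 2 := fun s =>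
    (hweak s).subset hXU hXconvex
  have hρ1 : Integrable ρ P := hρsq.integrable one_le_two
  set F := population P f with hF
  set r := ∫ s, ρ s ∂P with hr
  have hFconv : ConvexOn ℝ X fun y => F y + r / 2 * ‖y‖ ^ 2 :=
    convexOn_population_add_sq hweakX hXconvex hfint hρ1
  have hFlsc : LowerSemicontinuousOn F X := lowerSemicontinuousOn_population hweakX hXconvex
    (fun s => (continuousOn_loss hUopen (hweak s)).mono hXU) hfint hρ1
  -- the proximal map of the constrained objective
  have hprox : ∀ z, ∃ y ∈ X, IsMinOn (fun y => F y + lam / 2 * ‖y - z‖ ^ 2) X y := by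
    intro z
    have hc : Continuous fun y => lam / 2 * ‖y - z‖ ^ 2 := by fun_prop
    exact exists_isMinOn_of_strongConvexOn hXclosed hXne (sub_pos.2 hlam)
      (strongConvexOn_add_sq hFconv lam z)
      (hFlsc.add (hc.lowerSemicontinuous.lowerSemicontinuousOn _))
  choose xh hxh hmin using hprox
  have hgrad := hasGradientAt_moreauEnvelope hlam0 hlam hFconv hxh hmin
  set M := moreauEnvelope X F lam with hM
  have hdiff : Differentiable ℝ M := fun z => (hgrad z).differentiableAt
  have hxhc : Continuous xh := (LipschitzWith.of_dist_le_mul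
    (K := ⟨lam / (lam - r), div_nonneg hlam0 (sub_pos.2 hlam).le⟩) fun y z => by
      rw [dist_eq_norm, dist_eq_norm]
      exact prox_lipschitz hlam0 hlam hFconv hxh hmin y z).continuous
  have hMm : Measurable M := hdiff.continuous.measurable
  obtain ⟨β, hβ'⟩ := hbdd
  have hβ : ∀ y ∈ X, β ≤ F y := fun y hy => hβ' ⟨y, hy, rfl⟩
  obtain ⟨A, B, hA, hB, hprog⟩ := exists_integral_moreauEnvelope_le hUopen hXU hXclosed hXconvex
    hfmeas hρmeas hweak hfint hvar hρsq hlam0 hxh hmin hMm hβ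
  choose T hTm hT using fun k =>
    exists_measurable_modelStep hUopen hXU hXclosed hXconvex hXne hfmeas hρmeas hweak (hαpos k)
  -- By uniqueness of the minimizer, the given iterates follow the measurable step maps.
  have hxT : ∀ k ω, x (k + 1) ω = T k (x k ω) (S k ω) := fun k ω =>
    (hstep k ω).unique (hweakX _) (hαpos k) (hT k _ _)
  let ℱ := pastFiltration S hSmeas
  have hxad : ∀ k, Measurable[ℱ k] (x k) := by
    intro k
    induction k with
    | zero => rw [show x 0 = fun _ => x₀ from funext hx₀]; exact measurable_const
    | succ k ih =>
      rw [show x (k + 1) = fun ω => T k (x k ω) (S k ω) from funext (hxT k)]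
      exact (hTm k).comp ((ih.mono (ℱ.mono k.le_succ) le_rfl).prodMk
        (measurable_pastFiltration_succ hSmeas k))
  -- the expected decrease of the envelope per unit of stepsize
  let D : EuclideanSpace ℝ (Fin n) → ℝ := fun z => lam * (lam - r) * ‖z - xh z‖ ^ 2
  have hDm : Measurable D := by
    have : Continuous D := by fun_prop
    exact this.measurable
  have hlr : 0 < lam - r := sub_pos.2 hlam
  have hD0 : ∀ z, 0 ≤ D z := fun z => by positivity
  have hMβ : ∀ z, lam / 2 * ‖z - xh z‖ ^ 2 ≤ M z - β := fun z => by
    rw [hM, moreauEnvelope_eq (hxh z) (hmin z), norm_sub_rev]; linarith [hβ _ (hxh z)]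
  have hM0 : ∀ z, 0 ≤ M z - β := fun z => le_trans (by positivity) (hMβ z)
  have hDM : ∀ z, D z ≤ 2 * (lam - r) * (M z - β) := fun z => by
    have := mul_le_mul_of_nonneg_left (hMβ z) (show 0 ≤ 2 * (lam - r) by positivity)
    simp only [D]; linarith
  have hDint : ∀ k, Integrable (fun ω => M (x k ω) - β) μ → Integrable (fun ω => D (x k ω)) μ :=
    fun k hk => (hk.const_mul (2 * (lam - r))).mono'
      (hDm.comp ((hxad k).mono (ℱ.le k) le_rfl)).aestronglyMeasurable
      (Eventually.of_forall fun ω => by rw [Real.norm_of_nonneg (hD0 _)]; exact hDM _)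
  have hkey : ∀ k, Integrable (fun ω => M (x k ω) - β) μ →
      Integrable (fun ω => M (x (k + 1) ω) - β) μ ∧ ∀ A', MeasurableSet[ℱ k] A' →
        ∫ ω in A', (M (x (k + 1) ω) - β) ∂μ ≤ ∫ ω in A', ((1 + A * α k ^ 2) * (M (x k ω) - β)
          + B * α k ^ 2 - α k * D (x k ω)) ∂μ := by
    intro k hk
    simp_rw [hxT k]
    have hTk : ∀ z, Measurable (T k z) := fun z => (hTm k).comp measurable_prodMk_left
    exact setIntegral_comp_le_of_indep (Φ := fun z s => M (T k z s) - β)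
      (ψ := fun z => (1 + A * α k ^ 2) * (M z - β) + B * α k ^ 2 - α k * D z) (ℱ.le k) (hxad k)
      (hSmeas k) (indep_pastFiltration hSmeas hSindep k) ((hMm.comp (hTm k)).sub_const β)
      (fun _ _ => hM0 _)
      (fun z => by rw [hSlaw]; exact (hprog z _ _ (hαpos k) (hTk z) (hT k z)).1)
      (fun z => by rw [hSlaw]; exact (hprog z _ _ (hαpos k) (hTk z) (hT k z)).2)
      (((hk.const_mul _).add (integrable_const _)).sub ((hDint k hk).const_mul _))
  have hMint : ∀ k, Integrable (fun ω => M (x k ω) - β) μ := by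
    intro k
    induction k with
    | zero => simp_rw [hx₀]; exact integrable_const _
    | succ k ih => exact (hkey k ih).1
  have hconv := ae_tendsto_and_summable_of_almost_supermartingale (ℱ := ℱ)
    (V := fun k ω => M (x k ω) - β) (D := fun k ω => α k * D (x k ω))
    (a := fun k => A * α k ^ 2) (b := fun k => B * α k ^ 2)
    (fun k => (((hMm.comp (hxad k)).sub_const β).stronglyMeasurable))
    (fun k => (((hDm.comp (hxad k)).const_mul _).stronglyMeasurable)) hMint
    (fun k => (hDint k (hMint k)).const_mul _) (fun k ω => hM0 _)
    (fun k ω => mul_nonneg (hαpos k).le (hD0 _)) (fun k => by positivity) (fun k => by positivity)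
    (hαsq.mul_left A) (hαsq.mul_left B) fun k => (hkey k (hMint k)).2
  refine ⟨hdiff, ?_, ?_⟩
  · have hex : ∀ᵐ ω ∂μ, ∃ l, Tendsto (fun k => M (x k ω)) atTop (𝓝 l) := by
      filter_upwards [hconv] with ω hω
      obtain ⟨l, hl⟩ := hω.1
      exact ⟨l + β, by simpa using hl.add_const β⟩
    exact measurable_limit_of_tendsto_metrizable_ae
      (fun k => (hMm.comp ((hxad k).mono (ℱ.le k) le_rfl)).aemeasurable) hex
  · filter_upwards [hconv] with ω hω
    refine (hω.2.mul_left (lam / (lam - r))).congr fun k => ?_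
    rw [(hgrad _).gradient, norm_smul, mul_pow, Real.norm_eq_abs, sq_abs]
    simp only [D]
    field_simp
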